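/- Let $X$ be a connected (non-empty, Hausdorff) CW-complex with base point $x_0$ and let $\Gamma=\pi_1(X,x_0)$. A \emph{subgroup family} of $\Gamma$ is a non-empty set $F$ of subgroups of $\Gamma$ that is closed under conjugation and under taking subgroups. For such an $F$, let $\mathrm{cat}_F(X)\in\mathbb{N}_{\ge 1}\cup\{\infty\}$ be the minimal cardinality of an open cover of $X$ by sets $U$ such that $\mathrm{im}(\pi_1(U,x)\to\pi_1(X,x))$ lies in $F$ for every $x\in U$; here $\pi_1(X,x)$ is identified with $\Gamma$ along a path from $x$ to $x_0$ (since $F$ is closed under conjugation, the choice of the path does not matter). The \emph{amenable category} $\mathrm{amcat}(X)$ is defined in the same way, by requiring instead that $\mathrm{im}(\pi_1(U,x)\to\pi_1(X,x))$ is an amenable group for every $x\in U$. A \emph{graph of groups} consists of a non-empty connected graph (loops and multiple edges allowed), a group for each vertex and for each edge, and injective homomorphisms from each edge group into the groups of the two endpoints of the edge. Its vertex and edge groups map canonically, up to conjugation, to its fundamental group. (1) If $F$ is a subgroup family of $\Gamma$ and $\mathrm{cat}_F(X)\le 2$, then there are a graph of groups $\mathcal{G}$ and an isomorphism $\pi_1(\mathcal{G})\cong\Gamma$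 such that all vertex groups and all edge groups of $\mathcal{G}$ embed into $\pi_1(\mathcal{G})$ and correspond under this isomorphism to subgroups of $\Gamma$ that lie in $F$. (2) If $\mathrm{amcat}(X)\le 2$, then $\Gamma$ is isomorphic to the fundamental group of a graph of groups all of whose vertex groups and edge groups are amenable. -/

import Mathlib

universe u

/-! ### Graphs of groups and their fundamental groups -/

/-- A graph of groups. The underlying graph may have loops and multiple edges; every geometric edge
carries one chosen orientation, and the reversed edge appears below as the inverse of the
corresponding letter. Each edge group has injective homomorphisms into the groups of both
endpoints. -/
structure GraphOfGroups where
  /-- vertices -/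
  V : Type u
  /-- (oriented) edges -/
  E : Type u
  /-- origin of an edge -/
  src : E → V
  /-- terminus of an edge -/
  tgt : E → V
  /-- vertex groups -/
  vGroup : V → Type u
  /-- edge groups -/
  eGroup : E → Type u
  [vGroupInst : ∀ v, Group (vGroup v)]
  [eGroupInst : ∀ e, Group (eGroup e)]
  /-- edge group into the group of the origin -/
  srcHom : ∀ e, eGroup e →* vGroup (src e)
  /-- edge group into the group of the terminus -/
  tgtHom : ∀ e, eGroup e →* vGroup (tgt e)
  srcHom_injective : ∀ e, Function.Injective (srcHom e)
  tgtHom_injective : ∀ e, Function.Injective (tgtHom e)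

namespace GraphOfGroups

attribute [instance] GraphOfGroups.vGroupInst GraphOfGroups.eGroupInst

variable (𝒢 : GraphOfGroups.{u})

/-- The underlying graph is non-empty and connected. -/
def Connected : Prop :=
  Nonempty 𝒢.V ∧
    ∀ v w : 𝒢.V, Relation.EqvGen (fun a b => ∃ e : 𝒢.E, 𝒢.src e = a ∧ 𝒢.tgt e = b) v w

/-- The free product of all vertex groups and the free group on the edges. -/
abbrev FreeProd : Type u :=
  Monoid.Coprod (Monoid.CoprodI 𝒢.vGroup) (FreeGroup 𝒢.E)

/-- The relators `e · tgtHom e a · e⁻¹ · (srcHom e a)⁻¹`, for edges `e` and `a` in the edge group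
of `e`. -/
def relators : Set 𝒢.FreeProd :=
  {r | ∃ (e : 𝒢.E) (a : 𝒢.eGroup e),
    r = Monoid.Coprod.inr (FreeGroup.of e)
      * Monoid.Coprod.inl (Monoid.CoprodI.of (𝒢.tgtHom e a))
      * (Monoid.Coprod.inr (FreeGroup.of e))⁻¹
      * (Monoid.Coprod.inl (Monoid.CoprodI.of (𝒢.srcHom e a)))⁻¹}

/-- The group generated by the vertex groups and the edges, subject to the relations
`e · tgtHom e a · e⁻¹ = srcHom e a`. -/
abbrev PathGroup : Type u :=
  𝒢.FreeProd ⧸ Subgroup.normalClosure 𝒢.relators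

/-- The element of the path group given by an element of a vertex group. -/
def ofVertex (v : 𝒢.V) : 𝒢.vGroup v →* 𝒢.PathGroup :=
  (QuotientGroup.mk' (Subgroup.normalClosure 𝒢.relators)).comp
    (Monoid.Coprod.inl.comp Monoid.CoprodI.of)

/-- The element of the path group given by an edge. -/
def ofEdge (e : 𝒢.E) : 𝒢.PathGroup :=
  QuotientGroup.mk' (Subgroup.normalClosure 𝒢.relators)
    (Monoid.Coprod.inr (FreeGroup.of e))

/-- `𝒢.IsPath v w x` means that `x` is represented by a word `g₀ e₁ g₁ e₂ … eₙ gₙ` where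
`e₁ e₂ … eₙ` is an edge path from `v` to `w` (edges may be traversed backwards, which contributes
the inverse letter) and each `gᵢ` lies in the group of the `i`-th vertex on that path. -/
inductive IsPath : 𝒢.V → 𝒢.V → 𝒢.PathGroup → Prop
  | vertex (v : 𝒢.V) (g : 𝒢.vGroup v) : IsPath v v (𝒢.ofVertex v g)
  | edge (e : 𝒢.E) : IsPath (𝒢.src e) (𝒢.tgt e) (𝒢.ofEdge e)
  | edgeInv (e : 𝒢.E) : IsPath (𝒢.tgt e) (𝒢.src e) (𝒢.ofEdge e)⁻¹
  | comp {v w z : 𝒢.V} {x y : 𝒢.PathGroup} (hx : IsPath v w x) (hy : IsPath w z y) :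
      IsPath v z (x * y)

variable {𝒢}

theorem IsPath.inv {v w : 𝒢.V} {x : 𝒢.PathGroup} (h : 𝒢.IsPath v w x) : 𝒢.IsPath w v x⁻¹ := by
  induction h with
  | vertex v g => rw [← map_inv]; exact .vertex v g⁻¹
  | edge e => exact .edgeInv e
  | edgeInv e => rw [inv_inv]; exact .edge e
  | comp _ _ ihx ihy => rw [mul_inv_rev]; exact .comp ihy ihx

variable (𝒢)

/-- The fundamental group of a graph of groups at a base vertex: the classes of closed paths at
this vertex. -/
def fundamentalGroup (v₀ : 𝒢.V) : Subgroup 𝒢.PathGroup where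
  carrier := {x | 𝒢.IsPath v₀ v₀ x}
  mul_mem' hx hy := .comp hx hy
  one_mem' := by
    have h := IsPath.vertex v₀ (1 : 𝒢.vGroup v₀)
    rwa [map_one] at h
  inv_mem' h := h.inv

variable {𝒢}

/-- The homomorphism from the group of the vertex `v` into the fundamental group at `v₀`,
`g ↦ x g x⁻¹`, determined by a path `x` from `v₀` to `v`. Another choice of path changes it by a
conjugation in the fundamental group. -/
def vertexHom {v₀ v : 𝒢.V} {x : 𝒢.PathGroup} (hx : 𝒢.IsPath v₀ v x) :
    𝒢.vGroup v →* 𝒢.fundamentalGroup v₀ :=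
  ((MulAut.conj x).toMonoidHom.comp (𝒢.ofVertex v)).codRestrict (𝒢.fundamentalGroup v₀)
    (fun g => (hx.comp (.vertex v g)).comp hx.inv)

/-- The homomorphism from the group of the edge `e` into the fundamental group at `v₀`
determined by a path from `v₀` to the origin of `e`. -/
def edgeHom {v₀ : 𝒢.V} {e : 𝒢.E} {x : 𝒢.PathGroup} (hx : 𝒢.IsPath v₀ (𝒢.src e) x) :
    𝒢.eGroup e →* 𝒢.fundamentalGroup v₀ :=
  (vertexHom hx).comp (𝒢.srcHom e)

end GraphOfGroups

/-! ### Categories of spaces -/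

/-- A subgroup family: a non-empty set of subgroups closed under conjugation and under taking
subgroups. -/
structure IsSubgroupFamily {Γ : Type u} [Group Γ] (F : Set (Subgroup Γ)) : Prop where
  nonempty : F.Nonempty
  conj_mem : ∀ H ∈ F, ∀ g : Γ, H.map (MulAut.conj g).toMonoidHom ∈ F
  subgroup_mem : ∀ H ∈ F, ∀ K : Subgroup Γ, K ≤ H → K ∈ F

section Category

variable {X : Type u} [TopologicalSpace X]

/-- The image of `π₁(U, x) → π₁(X, x)`. -/
noncomputable def inclusionImage (U : Set X) (x : U) : Subgroup (FundamentalGroup X (x : X)) :=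
  (FundamentalGroup.map (⟨Subtype.val, continuous_subtype_val⟩ : C(U, X)) x).range

/-- `U` is an `F`-set, for a family `F` of subgroups of `π₁(X, x₀)` (`X` path-connected):
the image of `π₁(U, x) → π₁(X, x)` lies in `F` for all `x ∈ U`. Here `π₁(X, x)` is identified with
`π₁(X, x₀)` along a path; as `F` is closed under conjugation, the choice of path is immaterial. -/
def IsFSet (x₀ : X) (F : Set (Subgroup (FundamentalGroup X x₀))) (U : Set X) : Prop :=
  ∀ (x : U) (p : Path (x : X) x₀),
    (inclusionImage U x).map
      (FundamentalGroup.fundamentalGroupMulEquivOfPath p).toMonoidHom ∈ F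

/-- The least cardinality of an open cover of `X` by at least one set, all with the property `P`,
or `∞` if there is no finite such cover. -/
noncomputable def coverCat (P : Set X → Prop) : ℕ∞ :=
  sInf {n : ℕ∞ | 1 ≤ n ∧ ∃ 𝒰 : Set (Set X), 𝒰.encard = n ∧
    (∀ U ∈ 𝒰, IsOpen U ∧ P U) ∧ ⋃₀ 𝒰 = Set.univ}

/-- The `F`-category of `X`. -/
noncomputable def familyCat (x₀ : X) (F : Set (Subgroup (FundamentalGroup X x₀))) : ℕ∞ :=
  coverCat (IsFSet x₀ F)

/-- A (discrete) group is amenable if it has a left-invariant finitely additive probability measure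
defined on all subsets. -/
def IsAmenable (G : Type u) [Group G] : Prop :=
  ∃ μ : Set G → NNReal, μ Set.univ = 1 ∧
    (∀ A B : Set G, Disjoint A B → μ (A ∪ B) = μ A + μ B) ∧
    ∀ (g : G) (A : Set G), μ ((fun a => g * a) '' A) = μ A

variable (X) in
/-- The amenable category of `X`: covers by open sets `U` such that the image of
`π₁(U, x) → π₁(X, x)` is amenable for all `x ∈ U`. -/
noncomputable def amenableCat : ℕ∞ :=
  coverCat (fun U : Set X => ∀ x : U, IsAmenable (inclusionImage U x))

end Category

/-! Let `U`, `V` be open sets covering `X`. Take the bipartite graph whose vertices are the path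
components of `U` and of `V` and whose edges are the path components of `U ∩ V`, and attach to each
component the image of its fundamental group in Γ. Since these are subgroups of Γ, the edge maps (an
inclusion on the `U` side, a conjugation on the `V` side) are injective. The vertex groups lie in
the family, or are amenable, by the choice of the cover; edge groups inherit this as subgroups.

It remains to identify the fundamental group of this graph of groups with Γ, a Seifert–van Kampen
theorem for disconnected pieces. `toFundamentalGroup` maps the path group to Γ. Conversely, path
classes in `U` or in `V` receive values in the path group, which agree over `U ∩ V` by the edge
relations (`valU_eq_valV`). `LocallyMultiplicative.exists_extension` extends these values to all
path classes, by developing maps on intervals and squares. The values depend only on classes in `X`,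
so using images instead of the fundamental groups of the pieces does no harm. Surjectivity follows
from `toFundamentalGroup_eq`; injectivity from `loopHom_toFundamentalGroup`, by which one composite
is a conjugation on closed paths. The CW structure provides path-connectedness. -/

/-! ### Developing maps and local-to-global extension of path invariants -/

section Developing

open unitInterval

variable {X : Type*} [TopologicalSpace X] {P : Type*} [Group P] {ι : Type*}

/-- An assignment of group elements to paths is locally multiplicative for the cover `c` if it is
compatible with homotopies and concatenations of paths that stay inside one member of `c`. -/
def LocallyMultiplicative (c : ι → Set X) (val : ∀ ⦃x y : X⦄, Path x y → P) : Prop :=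
  ∀ (i : ι) (x y z : X) (γ₁ : Path x y) (γ₂ : Path y z) (γ₃ : Path x z),
    (∀ t, γ₁ t ∈ c i) → (∀ t, γ₂ t ∈ c i) → (∀ t, γ₃ t ∈ c i) →
    (γ₁.trans γ₂).Homotopic γ₃ → val γ₃ = val γ₂ * val γ₁

/-- Needed for paths whose endpoints agree only propositionally, such as segments pulled back along
an affine map. -/
theorem Path.apply_congr_of_eq {β : Sort*} (val : ∀ ⦃x y : X⦄, Path x y → β) {x y x' y' : X}
    (γ : Path x y) (γ' : Path x' y') (h : ∀ t, γ t = γ' t) : val γ = val γ' := by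
  obtain rfl : x = x' := by simpa using h 0
  obtain rfl : y = y' := by simpa using h 1
  congr 1
  ext t
  exact h t

namespace LocallyMultiplicative

variable {c : ι → Set X} {val : ∀ ⦃x y : X⦄, Path x y → P}

/-- The value of a constant path is idempotent in a group. -/
theorem map_refl (hval : LocallyMultiplicative c val) {i : ι} {x : X} (hx : x ∈ c i) :
    val (Path.refl x) = 1 := by
  have h := hval i x x x (Path.refl x) (Path.refl x) (Path.refl x) (fun _ => hx) (fun _ => hx)
    (fun _ => hx) (Path.Homotopic.refl_trans _)
  simpa using h

end LocallyMultiplicative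

/-! ### Developing maps on compact convex sets -/

variable {E : Type*} [NormedAddCommGroup E]

theorem exists_lebesgue {c : ι → Set X} (hc : ∀ i, IsOpen (c i)) (hcov : ⋃ i, c i = Set.univ)
    (f : C(E, X)) {K : Set E} (hK : IsCompact K) :
    ∃ δ > 0, ∀ x ∈ K, ∃ i, Metric.ball x δ ⊆ f ⁻¹' (c i) :=
  lebesgue_number_lemma_of_metric hK (fun i => (hc i).preimage f.continuous) (by
    rw [← Set.preimage_iUnion, hcov]; simp)

variable [NormedSpace ℝ E]

/-- The image under `f` of the segment from `p` to `q`. -/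
def segPath (f : C(E, X)) (p q : E) : Path (f p) (f q) where
  toFun t := f (AffineMap.lineMap p q (t : ℝ))
  continuous_toFun := by
    refine f.continuous.comp ?_
    exact (AffineMap.lineMap_continuous (R := ℝ)).comp continuous_subtype_val
  source' := by simp
  target' := by simp

theorem segPath_apply (f : C(E, X)) (p q : E) (t : I) :
    segPath f p q t = f (AffineMap.lineMap p q (t : ℝ)) := rfl

theorem segPath_self (f : C(E, X)) (p : E) : segPath f p p = Path.refl (f p) := by
  ext t; simp [segPath_apply]

/-- The homotopy exists in the simply connected space `E`, and `f` carries it to `X`. -/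
theorem segPath_trans_homotopic (f : C(E, X)) (p q r : E) :
    ((segPath f p q).trans (segPath f q r)).Homotopic (segPath f p r) := by
  let seg : ∀ a b : E, Path a b := fun a b => segPath (ContinuousMap.id E) a b
  have h := Path.Homotopic.map
    (SimplyConnectedSpace.paths_homotopic ((seg p q).trans (seg q r)) (seg p r)) f
  rw [Path.map_trans] at h
  exact h

theorem segPath_mem {f : C(E, X)} {p q : E} {B : Set E} (hB : Convex ℝ B) (hp : p ∈ B)
    (hq : q ∈ B) {A : Set X} (hA : B ⊆ f ⁻¹' A) (t : I) : segPath f p q t ∈ A :=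
  hA (hB.lineMap_mem hp hq t.2)

theorem LocallyMultiplicative.segPath {c : ι → Set X} {val : ∀ ⦃x y : X⦄, Path x y → P}
    (hval : LocallyMultiplicative c val) {i : ι} (f : C(E, X)) {B : Set E} (hB : Convex ℝ B)
    (hA : B ⊆ f ⁻¹' (c i)) {p q r : E} (hp : p ∈ B) (hq : q ∈ B) (hr : r ∈ B) :
    val (segPath f p r) = val (segPath f q r) * val (segPath f p q) :=
  hval i _ _ _ _ _ _ (segPath_mem hB hp hq hA) (segPath_mem hB hq hr hA)
    (segPath_mem hB hp hr hA) (segPath_trans_homotopic f p q r)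

/-- A developing map of `f` on `K`: locally, `h` changes along segments by the values of `val`. -/
def IsDev (val : ∀ ⦃x y : X⦄, Path x y → P) (f : C(E, X)) (K : Set E) (h : E → P) : Prop :=
  ∃ δ > 0, ∀ p ∈ K, ∀ q ∈ K, dist p q < δ → h q = val (segPath f p q) * h p

/-- Radial construction: `h p` is the product of the values along the segment from `p₀` to `p`, cut
into `n` pieces with the same `n` for all `p`. For nearby `p` and `q` the two subdivided segments
form a ladder, each quadrilateral of which is mapped into one member of the cover, so the comparison
passes from rung to rung. -/
theorem exists_isDev {c : ι → Set X} (hc : ∀ i, IsOpen (c i)) (hcov : ⋃ i, c i = Set.univ)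
    {val : ∀ ⦃x y : X⦄, Path x y → P} (hval : LocallyMultiplicative c val)
    (f : C(E, X)) {K : Set E} (hK : IsCompact K) (hconv : Convex ℝ K) (hne : K.Nonempty) :
    ∃ h, IsDev val f K h := by
  obtain ⟨δ, hδ, hball⟩ := exists_lebesgue hc hcov f hK
  obtain ⟨p₀, hp₀⟩ := hne
  obtain ⟨R, hR⟩ := hK.isBounded.subset_closedBall p₀
  -- All pieces become shorter than `δ / 3`; the maximum with 0 keeps `n` positive.
  obtain ⟨n, hn⟩ := exists_nat_gt (max (R / (δ / 3)) 0)
  have hn0 : (0 : ℝ) < n := lt_of_le_of_lt (le_max_right _ _) hn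
  have hRn : R / n < δ / 3 := by
    rw [div_lt_iff₀ hn0]
    have := lt_of_le_of_lt (le_max_left _ _) hn
    rw [div_lt_iff₀ (by positivity)] at this
    linarith
  let pt : ℕ → E → E := fun k p => AffineMap.lineMap p₀ p ((k : ℝ) / n)
  let hk : ℕ → E → P := fun k p =>
    Nat.rec 1 (fun j g => val (segPath f (pt j p) (pt (j + 1) p)) * g) k
  have hk0 : ∀ p, hk 0 p = 1 := fun p => rfl
  have hks : ∀ k p, hk (k + 1) p = val (segPath f (pt k p) (pt (k + 1) p)) * hk k p :=
    fun k p => rfl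
  have hptmem : ∀ k ≤ n, ∀ p ∈ K, pt k p ∈ K := by
    intro k hkn p hp
    refine hconv.lineMap_mem hp₀ hp ⟨by positivity, ?_⟩
    rw [div_le_one hn0]; exact_mod_cast hkn
  have hstep : ∀ k p, p ∈ K → dist (pt k p) (pt (k + 1) p) < δ / 3 := by
    intro k p hp
    have h1 : dist (pt k p) (pt (k + 1) p) = dist p₀ p / n := by
      simp only [pt, dist_lineMap_lineMap, Real.dist_eq]
      have : (k : ℝ) / n - ((k + 1 : ℕ) : ℝ) / n = -(1 / n) := by push_cast; ring
      rw [this, abs_neg, abs_of_pos (by positivity)]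
      ring
    rw [h1]
    refine lt_of_le_of_lt ?_ hRn
    have := hR hp
    rw [Metric.mem_closedBall, dist_comm] at this
    gcongr
  have hside : ∀ k ≤ n, ∀ p q, dist p q < δ / 3 → dist (pt k p) (pt k q) < δ / 3 := by
    intro k hkn p q hpq
    refine lt_of_le_of_lt ?_ hpq
    have h1 : dist (pt k p) (pt k q) = (k : ℝ) / n * dist p q := by
      simp only [pt, AffineMap.lineMap_apply, vsub_eq_sub, vadd_eq_add, dist_eq_norm]
      rw [show ((k : ℝ) / n) • (p - p₀) + p₀ - (((k : ℝ) / n) • (q - p₀) + p₀)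
        = ((k : ℝ) / n) • (p - q) by rw [smul_sub, smul_sub, smul_sub]; abel]
      rw [norm_smul, Real.norm_of_nonneg (by positivity)]
    rw [h1]
    refine mul_le_of_le_one_left dist_nonneg ?_
    rw [div_le_one hn0]; exact_mod_cast hkn
  have main : ∀ p ∈ K, ∀ q ∈ K, dist p q < δ / 3 → ∀ k ≤ n,
      hk k q = val (segPath f (pt k p) (pt k q)) * hk k p := by
    intro p hp q hq hpq k
    induction k with
    | zero =>
      intro _
      have : pt 0 p = pt 0 q := by simp [pt]
      rw [hk0, hk0, this, segPath_self]
      obtain ⟨i, hi⟩ := hball _ (hptmem 0 (Nat.zero_le _) q hq)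
      rw [hval.map_refl (hi (Metric.mem_ball_self hδ)), one_mul]
    | succ k ih =>
      intro hkn
      have hkn' : k ≤ n := by omega
      rw [hks, hks, ih hkn', ← mul_assoc, ← mul_assoc]
      congr 1
      obtain ⟨i, hi⟩ := hball _ (hptmem k hkn' p hp)
      have b1 := hside k hkn' p q hpq
      have b2 := hstep k p hp
      have b3 := hstep k q hq
      have m0 : pt k p ∈ Metric.ball (pt k p) δ := Metric.mem_ball_self hδ
      have m1 : pt k q ∈ Metric.ball (pt k p) δ := by
        rw [Metric.mem_ball, dist_comm]; linarith
      have m2 : pt (k + 1) p ∈ Metric.ball (pt k p) δ := by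
        rw [Metric.mem_ball, dist_comm]; linarith
      have m3 : pt (k + 1) q ∈ Metric.ball (pt k p) δ := by
        rw [Metric.mem_ball, dist_comm]
        have := dist_triangle (pt k p) (pt k q) (pt (k + 1) q)
        linarith
      -- Both ways round the quadrilateral have the value of its diagonal from `pt k p` to `pt (k +
      -- 1) q`.
      rw [← hval.segPath f (convex_ball _ _) hi m0 m1 m3,
        ← hval.segPath f (convex_ball _ _) hi m0 m2 m3]
  refine ⟨hk n, δ / 3, by positivity, fun p hp q hq hpq => ?_⟩
  have h := main p hp q hq hpq n le_rfl
  have hpn : ∀ p, pt n p = p := by intro p; simp [pt, div_self hn0.ne']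
  rwa [hpn, hpn] at h

/-- Affine maps preserve segments, and as `g` does not increase distances the same `δ` works. -/
theorem IsDev.comp {E' : Type*} [NormedAddCommGroup E'] [NormedSpace ℝ E']
    {val : ∀ ⦃x y : X⦄, Path x y → P} {f : C(E, X)} {f' : C(E', X)} {K : Set E} {K' : Set E'}
    {h : E' → P} (hh : IsDev val f' K' h) (g : E →ᵃ[ℝ] E')
    (hg : ∀ p q, dist (g p) (g q) ≤ dist p q) (hgK : ∀ p ∈ K, g p ∈ K')
    (hK : Convex ℝ K) (hf : ∀ p ∈ K, f p = f' (g p)) : IsDev val f K (fun p => h (g p)) := by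
  obtain ⟨δ, hδ, H⟩ := hh
  refine ⟨δ, hδ, fun p hp q hq hpq => ?_⟩
  beta_reduce
  rw [H _ (hgK p hp) _ (hgK q hq) ((hg p q).trans_lt hpq)]
  congr 1
  refine Path.apply_congr_of_eq val _ _ fun t => ?_
  rw [segPath_apply, segPath_apply, hf _ (hK.lineMap_mem hp hq t.2), AffineMap.apply_lineMap]

/-- Along a subdivision finer than both constants, the two maps are multiplied on the left by the
same values. -/
theorem IsDev.unique {val : ∀ ⦃x y : X⦄, Path x y → P} {f : C(ℝ, X)} {h h' : ℝ → P}
    (hh : IsDev val f I h) (hh' : IsDev val f I h') :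
    h 1 * (h 0)⁻¹ = h' 1 * (h' 0)⁻¹ := by
  obtain ⟨δ, hδ, H⟩ := hh
  obtain ⟨δ', hδ', H'⟩ := hh'
  obtain ⟨n, hn⟩ := exists_nat_gt (max (1 / min δ δ') 0)
  have hn0 : (0 : ℝ) < n := lt_of_le_of_lt (le_max_right _ _) hn
  have hlt : 1 / (n : ℝ) < min δ δ' := by
    have := lt_of_le_of_lt (le_max_left _ _) hn
    rw [div_lt_iff₀ (lt_min hδ hδ')] at this
    rw [div_lt_iff₀ hn0]; linarith
  have mem : ∀ k ≤ n, (k : ℝ) / n ∈ I := fun k hk =>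
    ⟨by positivity, by rw [div_le_one hn0]; exact_mod_cast hk⟩
  have main : ∀ k ≤ n, h ((k : ℝ) / n) * (h 0)⁻¹ = h' ((k : ℝ) / n) * (h' 0)⁻¹ := by
    intro k
    induction k with
    | zero => simp
    | succ k ih =>
      intro hk
      have hd : dist ((k : ℝ) / n) (((k + 1 : ℕ) : ℝ) / n) < min δ δ' := by
        rw [Real.dist_eq, show (k : ℝ) / n - ((k + 1 : ℕ) : ℝ) / n = -(1 / n) by push_cast; ring,
          abs_neg, abs_of_pos (by positivity)]
        exact hlt
      rw [H _ (mem k (by omega)) _ (mem _ hk) (hd.trans_le (min_le_left _ _)),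
        H' _ (mem k (by omega)) _ (mem _ hk) (hd.trans_le (min_le_right _ _)),
        mul_assoc, mul_assoc, ih (by omega)]
  have := main n le_rfl
  rwa [div_self hn0.ne'] at this

/-- The change of a developing map along a path. -/
noncomputable def development (val : ∀ ⦃x y : X⦄, Path x y → P) {x y : X} (γ : Path x y) : P :=
  open scoped Classical in
  if H : ∃ h, IsDev val γ.extend I h then H.choose 1 * (H.choose 0)⁻¹ else 1

theorem development_eq {val : ∀ ⦃x y : X⦄, Path x y → P} {x y : X} {γ : Path x y} {h : ℝ → P}
    (hh : IsDev val γ.extend I h) : development val γ = h 1 * (h 0)⁻¹ := by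
  have H : ∃ h, IsDev val γ.extend I h := ⟨h, hh⟩
  rw [development, dif_pos H]
  exact H.choose_spec.unique hh

/-! ### Development along paths and its homotopy invariance -/

section

variable {c : ι → Set X} {val : ∀ ⦃x y : X⦄, Path x y → P}

theorem development_of_subset (hval : LocallyMultiplicative c val) {i : ι} {x y : X}
    (γ : Path x y) (hγ : ∀ t, γ t ∈ c i) : development val γ = val γ := by
  have hI : (I : Set ℝ) ⊆ γ.extend ⁻¹' (c i) := fun t ht => by
    rw [Set.mem_preimage, Path.extend_apply γ ht]; exact hγ _
  have h0 : (0 : ℝ) ∈ I := ⟨le_rfl, zero_le_one⟩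
  have h1 : (1 : ℝ) ∈ I := ⟨zero_le_one, le_rfl⟩
  -- The whole path lies in one member of the cover, so values from the starting point form a
  -- developing map at any scale; 1 is arbitrary.
  have hd : IsDev val γ.extend I (fun t => val (segPath γ.extend 0 t)) :=
    ⟨1, one_pos, fun p hp q hq _ => hval.segPath γ.extend (convex_Icc 0 1) hI h0 hp hq⟩
  rw [development_eq hd]
  rw [segPath_self, hval.map_refl (hI h0), inv_one, mul_one]
  refine Path.apply_congr_of_eq val _ _ fun t => ?_
  rw [segPath_apply, AffineMap.lineMap_apply]
  simp

variable (hc : ∀ i, IsOpen (c i)) (hcov : ⋃ i, c i = Set.univ)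
include hc hcov

/-- A developing map of the concatenation restricts to developing maps of both halves, and the
quotients telescope at the midpoint. -/
theorem development_trans (hval : LocallyMultiplicative c val) {x y z : X} (γ₁ : Path x y)
    (γ₂ : Path y z) :
    development val (γ₁.trans γ₂) = development val γ₂ * development val γ₁ := by
  obtain ⟨h, hh⟩ := exists_isDev hc hcov hval (γ₁.trans γ₂).extend isCompact_Icc
    (convex_Icc (0 : ℝ) 1) ⟨0, le_rfl, zero_le_one⟩
  have hd1 : IsDev val γ₁.extend I (fun t => h (AffineMap.lineMap (0 : ℝ) (1 / 2) t)) := by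
    refine hh.comp (AffineMap.lineMap (0 : ℝ) (1 / 2)) (fun p q => ?_) (fun p hp => ?_)
      (convex_Icc _ _) (fun p hp => ?_)
    · rw [dist_lineMap_lineMap]
      refine mul_le_of_le_one_right dist_nonneg ?_
      rw [Real.dist_eq]; norm_num [abs_of_pos]
    · simp only [AffineMap.lineMap_apply, vsub_eq_sub, vadd_eq_add, smul_eq_mul]
      obtain ⟨h0, h1⟩ := hp
      constructor <;> linarith
    · simp only [AffineMap.lineMap_apply, vsub_eq_sub, vadd_eq_add, smul_eq_mul]
      rw [Path.extend_trans_of_le_half _ _ (by linarith [hp.2])]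
      congr 1; ring
  have hd2 : IsDev val γ₂.extend I (fun t => h (AffineMap.lineMap (1 / 2 : ℝ) 1 t)) := by
    refine hh.comp (AffineMap.lineMap (1 / 2 : ℝ) 1) (fun p q => ?_) (fun p hp => ?_)
      (convex_Icc _ _) (fun p hp => ?_)
    · rw [dist_lineMap_lineMap]
      refine mul_le_of_le_one_right dist_nonneg ?_
      rw [Real.dist_eq, abs_of_neg] <;> norm_num
    · simp only [AffineMap.lineMap_apply, vsub_eq_sub, vadd_eq_add, smul_eq_mul]
      obtain ⟨h0, h1⟩ := hp
      constructor <;> linarith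
    · simp only [AffineMap.lineMap_apply, vsub_eq_sub, vadd_eq_add, smul_eq_mul]
      rw [Path.extend_trans_of_half_le _ _ (by linarith [hp.1])]
      congr 1; ring
  rw [development_eq hh, development_eq hd1, development_eq hd2]
  simp

/-- Develop the homotopy on the square. Two opposite sides are the given paths; the other two are
constant paths with development 1, so `h` agrees at their ends. -/
theorem development_homotopic (hval : LocallyMultiplicative c val) {x y : X} {γ₁ γ₂ : Path x y}
    (hγ : γ₁.Homotopic γ₂) : development val γ₁ = development val γ₂ := by
  obtain ⟨H⟩ := hγ
  -- Clamping the coordinates extends the homotopy to the plane, since developing maps are defined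
  -- over normed spaces.
  let f : C(ℝ × ℝ, X) :=
    ⟨fun p => H (Set.projIcc 0 1 zero_le_one p.1, Set.projIcc 0 1 zero_le_one p.2), by
      fun_prop⟩
  have hf : ∀ p, f p = H (Set.projIcc 0 1 zero_le_one p.1, Set.projIcc 0 1 zero_le_one p.2) :=
    fun _ => rfl
  have m0 : (0 : ℝ) ∈ I := ⟨le_rfl, zero_le_one⟩
  have m1 : (1 : ℝ) ∈ I := ⟨zero_le_one, le_rfl⟩
  obtain ⟨h, hh⟩ := exists_isDev hc hcov hval f (K := I ×ˢ I)
    (isCompact_Icc.prod isCompact_Icc) ((convex_Icc (0 : ℝ) 1).prod (convex_Icc (0 : ℝ) 1))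
    ⟨(0, 0), m0, m0⟩
  have horiz : ∀ s ∈ I, ∀ (a b : X) (γ : Path a b), (∀ t ∈ I, γ.extend t = f (s, t)) →
      development val γ = h (s, 1) * (h (s, 0))⁻¹ := by
    intro s hs a b γ hγ
    have hd : IsDev val γ.extend I
        (fun t => h (AffineMap.lineMap ((s, 0) : ℝ × ℝ) (s, 1) t)) := by
      refine hh.comp (AffineMap.lineMap ((s, 0) : ℝ × ℝ) (s, 1)) (fun p q => ?_) (fun p hp => ?_)
        (convex_Icc _ _) (fun p hp => ?_)
      · rw [dist_lineMap_lineMap]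
        simp [Prod.dist_eq]
      · rw [show AffineMap.lineMap ((s, 0) : ℝ × ℝ) (s, 1) p = (s, p) by
          simp [AffineMap.lineMap_apply]]
        exact ⟨hs, hp⟩
      · rw [hγ p hp]; simp [AffineMap.lineMap_apply]
    rw [development_eq hd]; simp
  have vert : ∀ s ∈ I, ∀ (a b : X) (γ : Path a b), (∀ t ∈ I, γ.extend t = f (t, s)) →
      development val γ = h (1, s) * (h (0, s))⁻¹ := by
    intro s hs a b γ hγ
    have hd : IsDev val γ.extend I
        (fun t => h (AffineMap.lineMap ((0, s) : ℝ × ℝ) (1, s) t)) := by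
      refine hh.comp (AffineMap.lineMap ((0, s) : ℝ × ℝ) (1, s)) (fun p q => ?_) (fun p hp => ?_)
        (convex_Icc _ _) (fun p hp => ?_)
      · rw [dist_lineMap_lineMap]
        simp [Prod.dist_eq]
      · rw [show AffineMap.lineMap ((0, s) : ℝ × ℝ) (1, s) p = (p, s) by
          simp [AffineMap.lineMap_apply]]
        exact ⟨hp, hs⟩
      · rw [hγ p hp]; simp [AffineMap.lineMap_apply]
    rw [development_eq hd]; simp
  have hrefl : ∀ a : X, development val (Path.refl a) = 1 := by
    intro a
    obtain ⟨i, hi⟩ := Set.mem_iUnion.1 (hcov ▸ Set.mem_univ a : a ∈ ⋃ i, c i)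
    rw [development_of_subset hval (Path.refl a) (fun _ => hi), hval.map_refl hi]
  have e1 := horiz 0 m0 _ _ γ₁ (fun t ht => by
    rw [Path.extend_apply _ ht, hf]
    simp [Set.projIcc_of_mem _ ht])
  have e2 := horiz 1 m1 _ _ γ₂ (fun t ht => by
    rw [Path.extend_apply _ ht, hf]
    simp [Set.projIcc_of_mem _ ht])
  have e3 := vert 0 m0 _ _ (Path.refl x) (fun t ht => by
    rw [hf]; simp)
  have e4 := vert 1 m1 _ _ (Path.refl y) (fun t ht => by
    rw [hf]; simp)
  rw [hrefl, eq_comm, mul_inv_eq_one] at e3 e4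
  rw [e1, e2, e3, e4]

/-- A locally multiplicative assignment extends to all homotopy classes of paths. -/
theorem LocallyMultiplicative.exists_extension (hval : LocallyMultiplicative c val) :
    ∃ D : ∀ {x y : X}, Path.Homotopic.Quotient x y → P,
      (∀ {x y z : X} (a : Path.Homotopic.Quotient x y) (b : Path.Homotopic.Quotient y z),
        D (a.trans b) = D b * D a) ∧
      ∀ (i : ι) {x y : X} (γ : Path x y), (∀ t, γ t ∈ c i) →
        D (Path.Homotopic.Quotient.mk γ) = val γ := by
  refine ⟨fun {x y} a => Quotient.lift (s := Path.Homotopic.setoid x y)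
    (fun γ : Path x y => development val γ)
    (fun γ₁ γ₂ h => development_homotopic hc hcov hval h) a, ?_, ?_⟩
  · intro x y z a b
    induction a using Path.Homotopic.Quotient.ind with | mk a =>
    induction b using Path.Homotopic.Quotient.ind with | mk b =>
    exact development_trans hc hcov hval a b
  · intro i x y γ hγ
    exact development_of_subset hval γ hγ

omit [Group P] in
/-- Homotopy classes of paths are generated by paths inside members of an open cover. -/
theorem pathClass_induction {Q : ∀ ⦃x y : X⦄, Path.Homotopic.Quotient x y → Prop}
    (small : ∀ (i : ι) {x y : X} (γ : Path x y), (∀ t, γ t ∈ c i) →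
      Q (Path.Homotopic.Quotient.mk γ))
    (trans : ∀ {x y z : X} (a : Path.Homotopic.Quotient x y) (b : Path.Homotopic.Quotient y z),
      Q a → Q b → Q (a.trans b)) {x y : X} (a : Path.Homotopic.Quotient x y) : Q a := by
  induction a using Path.Homotopic.Quotient.ind with | mk γ =>
  obtain ⟨δ, hδ, hball⟩ := exists_lebesgue hc hcov γ.extend (K := I) isCompact_Icc
  obtain ⟨n, hn⟩ := exists_nat_gt (max (1 / δ) 0)
  have hn0 : (0 : ℝ) < n := lt_of_le_of_lt (le_max_right _ _) hn
  have hlt : 1 / (n : ℝ) < δ := by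
    have := lt_of_le_of_lt (le_max_left _ _) hn
    rw [div_lt_iff₀ hδ] at this
    rw [div_lt_iff₀ hn0]; linarith
  have mem : ∀ k ≤ n, (k : ℝ) / n ∈ I := fun k hk =>
    ⟨by positivity, by rw [div_le_one hn0]; exact_mod_cast hk⟩
  have main : ∀ k ≤ n, Q (Path.Homotopic.Quotient.mk (segPath γ.extend 0 ((k : ℝ) / n))) := by
    intro k
    induction k with
    | zero =>
      intro _
      obtain ⟨i, hi⟩ := hball 0 ⟨le_rfl, zero_le_one⟩
      refine small i _ (segPath_mem (convex_ball 0 δ) (Metric.mem_ball_self hδ) ?_ hi)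
      simpa using hδ
    | succ k ih =>
      intro hk
      have hh : Path.Homotopic.Quotient.mk (segPath γ.extend 0 (((k + 1 : ℕ) : ℝ) / n)) =
          (Path.Homotopic.Quotient.mk (segPath γ.extend 0 ((k : ℝ) / n))).trans
          (Path.Homotopic.Quotient.mk
            (segPath γ.extend ((k : ℝ) / n) (((k + 1 : ℕ) : ℝ) / n))) := by
        rw [← Path.Homotopic.Quotient.mk_trans, eq_comm, Path.Homotopic.Quotient.eq]
        exact segPath_trans_homotopic _ _ _ _
      rw [hh]
      refine trans _ _ (ih (by omega)) ?_
      obtain ⟨i, hi⟩ := hball _ (mem k (by omega))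
      refine small i _ (segPath_mem (convex_ball _ δ) (Metric.mem_ball_self hδ) ?_ hi)
      rw [Metric.mem_ball, dist_comm, Real.dist_eq,
        show (k : ℝ) / n - ((k + 1 : ℕ) : ℝ) / n = -(1 / n) by push_cast; ring,
          abs_neg, abs_of_pos (by positivity)]
      exact hlt
  have h := main n le_rfl
  rw [div_self hn0.ne'] at h
  rw [Path.apply_congr_of_eq (fun x y p => Q (Path.Homotopic.Quotient.mk p)) γ
    (segPath γ.extend 0 1)]
  · exact h
  · intro t
    rw [segPath_apply, AffineMap.lineMap_apply]
    simp

end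

end Developing

/-! ### Framings -/

section Framings

open CategoryTheory

variable {X : Type u} [TopologicalSpace X]

/-- The class `a` is represented by a path inside `A`. -/
def InSet (A : Set X) {x y : X} (a : FundamentalGroupoid.mk x ⟶ FundamentalGroupoid.mk y) : Prop :=
  ∃ γ : Path x y, (∀ t, γ t ∈ A) ∧ Path.Homotopic.Quotient.mk γ = a

namespace InSet

variable {A B : Set X} {x y z : X}

theorem comp {a : FundamentalGroupoid.mk x ⟶ FundamentalGroupoid.mk y}
    {b : FundamentalGroupoid.mk y ⟶ FundamentalGroupoid.mk z} (ha : InSet A a) (hb : InSet A b) :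
    InSet A (a ≫ b) := by
  obtain ⟨γ, hγ, rfl⟩ := ha
  obtain ⟨γ', hγ', rfl⟩ := hb
  refine ⟨γ.trans γ', fun t => ?_, rfl⟩
  rw [Path.trans_apply]
  split_ifs
  · exact hγ _
  · exact hγ' _

theorem inv {a : FundamentalGroupoid.mk x ⟶ FundamentalGroupoid.mk y} (ha : InSet A a) :
    InSet A (CategoryTheory.inv a) := by
  obtain ⟨γ, hγ, rfl⟩ := ha
  refine ⟨γ.symm, fun t => hγ _, ?_⟩
  rw [← Groupoid.inv_eq_inv]
  rfl

theorem id (hx : x ∈ A) : InSet A (𝟙 (FundamentalGroupoid.mk x)) :=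
  ⟨Path.refl x, fun _ => hx, rfl⟩

theorem mono (h : A ⊆ B) {a : FundamentalGroupoid.mk x ⟶ FundamentalGroupoid.mk y}
    (ha : InSet A a) : InSet B a := by
  obtain ⟨γ, hγ, rfl⟩ := ha
  exact ⟨γ, fun t => h (hγ t), rfl⟩

theorem component_eq {x y : A} {a : FundamentalGroupoid.mk (x : X) ⟶ FundamentalGroupoid.mk (y : X)}
    (ha : InSet A a) : ZerothHomotopy.mk x = ZerothHomotopy.mk y := by
  obtain ⟨γ, hγ, rfl⟩ := ha
  exact Quotient.sound (JoinedIn.joined_subtype (x := (x : X)) (y := (y : X)) ⟨γ, hγ⟩)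

end InSet

theorem exists_inSet_of_component_eq {A : Set X} {x y : A}
    (h : ZerothHomotopy.mk x = ZerothHomotopy.mk y) :
    ∃ a : FundamentalGroupoid.mk (x : X) ⟶ FundamentalGroupoid.mk (y : X), InSet A a := by
  obtain ⟨γ⟩ : Joined x y := Quotient.exact h
  exact ⟨_, γ.map continuous_subtype_val, fun t => (γ t).2, rfl⟩

theorem mem_inclusionImage_iff {A : Set X} (x : A) (g : FundamentalGroup X (x : X)) :
    g ∈ inclusionImage A x ↔ InSet A g := by
  constructor
  · rintro ⟨a, rfl⟩
    obtain ⟨γ, rfl⟩ := Path.Homotopic.Quotient.mk_surjective a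
    exact ⟨γ.map continuous_subtype_val, fun t => (γ t).2, rfl⟩
  · rintro ⟨γ, hγ, rfl⟩
    refine ⟨Path.Homotopic.Quotient.mk
      { toFun := fun t => ⟨γ t, hγ t⟩
        continuous_toFun := by fun_prop
        source' := by simp
        target' := by simp }, rfl⟩

/-- A chosen point of a path component. -/
noncomputable def ZerothHomotopy.rep {Y : Type*} [TopologicalSpace Y] (i : ZerothHomotopy Y) : Y :=
  Quotient.out (s := pathSetoid Y) i

theorem ZerothHomotopy.mk_rep {Y : Type*} [TopologicalSpace Y] (i : ZerothHomotopy Y) :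
    ZerothHomotopy.mk i.rep = i :=
  Quotient.out_eq (s := pathSetoid Y) i

/-- Products run through the right factor first; hence the reversed order in `frameLoop_comp` and
`Extension.map_comp`. -/
theorem FundamentalGroup.mul_eq_comp {x : X} (g h : FundamentalGroup X x) : g * h = h ≫ g := rfl

theorem FundamentalGroup.inv_eq_inv {x : X} (g : FundamentalGroup X x) :
    g⁻¹ = CategoryTheory.inv (C := FundamentalGroupoid X) g :=
  Groupoid.inv_eq_inv (C := FundamentalGroupoid X) g

/-- The loop at `x₀` that follows `f`, then `a`, and returns along `g`. -/
noncomputable def frameLoop {x₀ x y : X} (f : FundamentalGroupoid.mk x₀ ⟶ FundamentalGroupoid.mk x)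
    (a : FundamentalGroupoid.mk x ⟶ FundamentalGroupoid.mk y)
    (g : FundamentalGroupoid.mk x₀ ⟶ FundamentalGroupoid.mk y) : FundamentalGroup X x₀ :=
  f ≫ a ≫ inv g

theorem frameLoop_comp {x₀ x y z : X}
    (f : FundamentalGroupoid.mk x₀ ⟶ FundamentalGroupoid.mk x)
    (g : FundamentalGroupoid.mk x₀ ⟶ FundamentalGroupoid.mk y)
    (h : FundamentalGroupoid.mk x₀ ⟶ FundamentalGroupoid.mk z)
    (a : FundamentalGroupoid.mk x ⟶ FundamentalGroupoid.mk y)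
    (b : FundamentalGroupoid.mk y ⟶ FundamentalGroupoid.mk z) :
    frameLoop f (a ≫ b) h = frameLoop g b h * frameLoop f a g := by
  rw [FundamentalGroup.mul_eq_comp]
  simp [frameLoop]

/-- Shifting the framing by a loop conjugates frame loops, which is the form of the edge relation.
-/
theorem frameLoop_shift {x₀ x y : X} (s : FundamentalGroup X x₀)
    (f : FundamentalGroupoid.mk x₀ ⟶ FundamentalGroupoid.mk x)
    (a : FundamentalGroupoid.mk x ⟶ FundamentalGroupoid.mk y)
    (g : FundamentalGroupoid.mk x₀ ⟶ FundamentalGroupoid.mk y) :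
    frameLoop (s ≫ f) a (s ≫ g) = s⁻¹ * frameLoop f a g * s := by
  rw [FundamentalGroup.mul_eq_comp, FundamentalGroup.mul_eq_comp, FundamentalGroup.inv_eq_inv]
  simp [frameLoop]

theorem frameLoop_inv_comp {x₀ x y : X}
    (f : FundamentalGroupoid.mk x₀ ⟶ FundamentalGroupoid.mk x)
    (g : FundamentalGroupoid.mk x₀ ⟶ FundamentalGroupoid.mk y) :
    frameLoop f (inv f ≫ g) g = 1 := by
  simp [frameLoop, End.one_def]

/-- A framing of `A`: path classes from `x₀` to the points of `A`, which for points of one path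
component of `A` differ by path classes in `A`. -/
structure Framing (x₀ : X) (A : Set X) where
  /-- the path class from `x₀` to `x` -/
  arrow : ∀ x : A, FundamentalGroupoid.mk x₀ ⟶ FundamentalGroupoid.mk (x : X)
  compat : ∀ x y : A, ZerothHomotopy.mk x = ZerothHomotopy.mk y →
    InSet A (inv (arrow x) ≫ arrow y)

namespace Framing

variable {x₀ : X} {A : Set X} (F : Framing x₀ A)

/-- The loops at `x₀` that the framing transports into a path component of `A`. -/
noncomputable def group (i : ZerothHomotopy A) : Subgroup (FundamentalGroup X x₀) where
  carrier := {g | InSet A (inv (F.arrow i.rep) ≫ g ≫ F.arrow i.rep)}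
  mul_mem' {g h} hg hh := by
    simp only [Set.mem_ofPred_eq, FundamentalGroup.mul_eq_comp] at *
    simpa using hh.comp hg
  one_mem' := by
    simp only [Set.mem_ofPred_eq, End.one_def]
    simpa using InSet.id i.rep.2
  inv_mem' {g} hg := by
    simp only [Set.mem_ofPred_eq, FundamentalGroup.inv_eq_inv] at *
    simpa using hg.inv

/-- By `compat`, the arrows at two points of a component differ by a class in `A`, so the
representative is immaterial. -/
theorem mem_group_mk_iff (x : A) (g : FundamentalGroup X x₀) :
    g ∈ F.group (ZerothHomotopy.mk x) ↔ InSet A (inv (F.arrow x) ≫ g ≫ F.arrow x) := by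
  set y := (ZerothHomotopy.mk x).rep with hy
  have hxy : ZerothHomotopy.mk x = ZerothHomotopy.mk y := (ZerothHomotopy.mk_rep _).symm
  have h1 := F.compat x y hxy
  have h2 := F.compat y x hxy.symm
  change InSet A (inv (F.arrow y) ≫ g ≫ F.arrow y) ↔ _
  constructor
  · intro h
    simpa using h1.comp (h.comp h2)
  · intro h
    simpa using h2.comp (h.comp h1)

theorem frameLoop_mem_group {x y : A}
    {a : FundamentalGroupoid.mk (x : X) ⟶ FundamentalGroupoid.mk (y : X)} (ha : InSet A a) :
    frameLoop (F.arrow x) a (F.arrow y) ∈ F.group (ZerothHomotopy.mk x) := by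
  rw [mem_group_mk_iff, frameLoop]
  simpa using ha.comp (F.compat y x ha.component_eq.symm)

/-- Links the group of a framing to the image subgroup used in `IsFSet` and `amenableCat`. -/
theorem group_eq_map (i : ZerothHomotopy A) (p : Path (i.rep : X) x₀)
    (hp : (Path.Homotopic.Quotient.mk p : FundamentalGroupoid.mk (i.rep : X) ⟶
      FundamentalGroupoid.mk x₀) = inv (F.arrow i.rep)) :
    F.group i = (inclusionImage A i.rep).map
      (FundamentalGroup.fundamentalGroupMulEquivOfPath p).toMonoidHom := by
  have key : ∀ g : FundamentalGroup X (i.rep : X),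
      FundamentalGroup.fundamentalGroupMulEquivOfPath p g =
        F.arrow i.rep ≫ g ≫ inv (F.arrow i.rep) := by
    intro g
    have : FundamentalGroup.fundamentalGroupMulEquivOfPath p g =
      Groupoid.inv (Path.Homotopic.Quotient.mk p : FundamentalGroupoid.mk (i.rep : X) ⟶
        FundamentalGroupoid.mk x₀) ≫ g ≫ (Path.Homotopic.Quotient.mk p) := rfl
    rw [this, hp]
    simp
  ext g
  constructor
  · intro hg
    refine ⟨inv (F.arrow i.rep) ≫ g ≫ F.arrow i.rep, (mem_inclusionImage_iff _ _).2 hg, ?_⟩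
    refine (key _).trans ?_
    simp
  · rintro ⟨h, hh, rfl⟩
    have h1 : InSet A h := (mem_inclusionImage_iff _ _).1 hh
    change InSet A (inv (F.arrow i.rep) ≫
      (FundamentalGroup.fundamentalGroupMulEquivOfPath p h) ≫ F.arrow i.rep)
    rw [key]
    simpa using h1

theorem group_mem_of_isFSet {𝓕 : Set (Subgroup (FundamentalGroup X x₀))} (hA : IsFSet x₀ 𝓕 A)
    (i : ZerothHomotopy A) : F.group i ∈ 𝓕 := by
  obtain ⟨p, hp⟩ := Path.Homotopic.Quotient.mk_surjective
    (inv (F.arrow i.rep) : FundamentalGroupoid.mk (i.rep : X) ⟶ FundamentalGroupoid.mk x₀)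
  rw [F.group_eq_map i p hp]
  exact hA _ p

/-- The group of a framing is isomorphic to the image of the fundamental group of the path
component. -/
theorem exists_group_mulEquiv (i : ZerothHomotopy A) :
    Nonempty (inclusionImage A i.rep ≃* F.group i) := by
  obtain ⟨p, hp⟩ := Path.Homotopic.Quotient.mk_surjective
    (inv (F.arrow i.rep) : FundamentalGroupoid.mk (i.rep : X) ⟶ FundamentalGroupoid.mk x₀)
  rw [F.group_eq_map i p hp]
  exact ⟨(inclusionImage A i.rep).equivMapOfInjective _ (MulEquiv.injective _)⟩

end Framing

theorem exists_framing [PathConnectedSpace X] (x₀ : X) (A : Set X) : Nonempty (Framing x₀ A) := by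
  have h : ∀ x : A, ∃ a : FundamentalGroupoid.mk ((ZerothHomotopy.mk x).rep : X) ⟶
      FundamentalGroupoid.mk (x : X), InSet A a :=
    fun x => exists_inSet_of_component_eq (ZerothHomotopy.mk_rep _)
  choose c hc using h
  let b : ∀ i : ZerothHomotopy A, FundamentalGroupoid.mk x₀ ⟶ FundamentalGroupoid.mk (i.rep : X) :=
    fun i => Path.Homotopic.Quotient.mk (PathConnectedSpace.somePath x₀ (i.rep : X))
  -- Two separate components with an equation `i = j` allow substitution, which is blocked while the
  -- representatives depend on `x` and `y`.
  have key : ∀ (i j : ZerothHomotopy A) (x y : A) (a : FundamentalGroupoid.mk (i.rep : X) ⟶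
      FundamentalGroupoid.mk (x : X)) (a' : FundamentalGroupoid.mk (j.rep : X) ⟶
      FundamentalGroupoid.mk (y : X)), InSet A a → InSet A a' → i = j →
      InSet A (inv (b i ≫ a) ≫ b j ≫ a') := by
    rintro i _ x y a a' ha ha' rfl
    simpa using ha.inv.comp ha'
  exact ⟨⟨fun x => b (ZerothHomotopy.mk x) ≫ c x, fun x y hxy => key _ _ x y _ _ (hc x) (hc y) hxy⟩⟩

/-- Framings of `U`, `V` and `U ∩ V`, such that those of `U` and `V` differ on each path component
of `U ∩ V` by a fixed loop. -/
structure CompatibleFramings (x₀ : X) (U V : Set X) where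
  /-- framing of the first set -/
  fU : Framing x₀ U
  /-- framing of the second set -/
  fV : Framing x₀ V
  /-- framing of the intersection -/
  fW : Framing x₀ (U ∩ V)
  /-- the loops by which the framings differ -/
  shift : ZerothHomotopy (U ∩ V : Set X) → FundamentalGroup X x₀
  fU_eq : ∀ x : (U ∩ V : Set X), fU.arrow ⟨x, x.2.1⟩ = fW.arrow x
  fV_eq : ∀ x : (U ∩ V : Set X), fV.arrow ⟨x, x.2.2⟩ = shift (ZerothHomotopy.mk x) ≫ fW.arrow x

/-- A framing of `A` can be modified on a subset, using path classes in `A`. -/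
theorem Framing.exists_modify {x₀ : X} {A B : Set X} (hB : B ⊆ A) (F : Framing x₀ A)
    (r : B → B) (c : ∀ x : B, FundamentalGroupoid.mk (r x : X) ⟶ FundamentalGroupoid.mk (x : X))
    (hc : ∀ x, InSet B (c x)) :
    ∃ F' : Framing x₀ A, ∀ x : B, F'.arrow ⟨x, hB x.2⟩ = F.arrow ⟨r x, hB (r x).2⟩ ≫ c x := by
  classical
  let f : ∀ x : A, FundamentalGroupoid.mk x₀ ⟶ FundamentalGroupoid.mk (x : X) := fun x =>
    if h : (x : X) ∈ B then F.arrow ⟨r ⟨x, h⟩, hB (r ⟨x, h⟩).2⟩ ≫ c ⟨x, h⟩ else F.arrow x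
  have hf : ∀ x, InSet A (inv (F.arrow x) ≫ f x) := by
    intro x
    by_cases h : (x : X) ∈ B
    · simp only [f, dif_pos h]
      have h1 : InSet A (c ⟨x, h⟩) := (hc ⟨x, h⟩).mono hB
      have h2 := F.compat x ⟨r ⟨x, h⟩, hB (r ⟨x, h⟩).2⟩ 
        (InSet.component_eq (A := A) (x := ⟨r ⟨x, h⟩, hB (r ⟨x, h⟩).2⟩) (y := x) h1).symm
      simpa using h2.comp h1
    · simp only [f, dif_neg h]
      simpa using InSet.id x.2
  refine ⟨⟨f, fun x y hxy => ?_⟩, fun x => ?_⟩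
  · simpa using (hf x).inv.comp ((F.compat x y hxy).comp (hf y))
  · simp [f, x.2]

/-- Over `U ∩ V` both framings are rerouted through the representative of the component, followed by
the same class `c x` in `U ∩ V`. They then differ only by the loop formed at the representative. -/
theorem exists_compatibleFramings [PathConnectedSpace X] (x₀ : X) (U V : Set X) :
    Nonempty (CompatibleFramings x₀ U V) := by
  obtain ⟨gU⟩ := exists_framing x₀ U
  obtain ⟨gV⟩ := exists_framing x₀ V
  let r : (U ∩ V : Set X) → (U ∩ V : Set X) := fun x => (ZerothHomotopy.mk x).rep
  have h : ∀ x : (U ∩ V : Set X), ∃ a : FundamentalGroupoid.mk (r x : X) ⟶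
      FundamentalGroupoid.mk (x : X), InSet (U ∩ V) a :=
    fun x => exists_inSet_of_component_eq (ZerothHomotopy.mk_rep _)
  choose c hc using h
  obtain ⟨fU, hU⟩ := gU.exists_modify Set.inter_subset_left r c hc
  obtain ⟨fV, hV⟩ := gV.exists_modify Set.inter_subset_right r c hc
  let bU : ∀ e : ZerothHomotopy (U ∩ V : Set X), FundamentalGroupoid.mk x₀ ⟶
    FundamentalGroupoid.mk (e.rep : X) := fun e => gU.arrow ⟨e.rep, e.rep.2.1⟩
  let bV : ∀ e : ZerothHomotopy (U ∩ V : Set X), FundamentalGroupoid.mk x₀ ⟶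
    FundamentalGroupoid.mk (e.rep : X) := fun e => gV.arrow ⟨e.rep, e.rep.2.2⟩
  have key : ∀ (i j : ZerothHomotopy (U ∩ V : Set X)) (x y : (U ∩ V : Set X))
      (a : FundamentalGroupoid.mk (i.rep : X) ⟶ FundamentalGroupoid.mk (x : X))
      (a' : FundamentalGroupoid.mk (j.rep : X) ⟶ FundamentalGroupoid.mk (y : X)),
      InSet (U ∩ V) a → InSet (U ∩ V) a' → i = j →
      InSet (U ∩ V) (inv (bU i ≫ a) ≫ bU j ≫ a') := by
    rintro i _ x y a a' ha ha' rfl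
    simpa using ha.inv.comp ha'
  refine ⟨⟨fU, fV, ⟨fun x => fU.arrow ⟨x, x.2.1⟩, fun x y hxy => ?_⟩,
    fun e => bV e ≫ inv (bU e), fun x => rfl, fun x => ?_⟩⟩
  · rw [hU x, hU y]
    exact key _ _ x y _ _ (hc x) (hc y) hxy
  · change fV.arrow ⟨x, x.2.2⟩ = (bV _ ≫ inv (bU _)) ≫ fU.arrow ⟨x, x.2.1⟩
    rw [hU x, hV x]
    simp [bU, bV, r]

end Framings

/-! ### The graph of groups of a cover by two open sets -/

theorem GraphOfGroups.ofEdge_conj (𝒢 : GraphOfGroups.{u}) (e : 𝒢.E) (a : 𝒢.eGroup e) :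
    𝒢.ofEdge e * 𝒢.ofVertex (𝒢.tgt e) (𝒢.tgtHom e a) * (𝒢.ofEdge e)⁻¹ =
      𝒢.ofVertex (𝒢.src e) (𝒢.srcHom e a) := by
  rw [← mul_inv_eq_one]
  exact (QuotientGroup.eq_one_iff _).2 (Subgroup.subset_normalClosure ⟨e, a, rfl⟩)

namespace CompatibleFramings

open CategoryTheory

variable {X : Type u} [TopologicalSpace X] {x₀ : X} {U V : Set X} (𝔉 : CompatibleFramings x₀ U V)

/-- The vertex groups. -/
noncomputable def vertexSubgroup :
    ZerothHomotopy U ⊕ ZerothHomotopy V → Subgroup (FundamentalGroup X x₀) :=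
  Sum.elim 𝔉.fU.group 𝔉.fV.group

theorem edge_mem_left (x : (U ∩ V : Set X)) {g : FundamentalGroup X x₀}
    (hg : g ∈ 𝔉.fW.group (ZerothHomotopy.mk x)) :
    g ∈ 𝔉.vertexSubgroup (Sum.inl (ZerothHomotopy.mk ⟨x, x.2.1⟩)) := by
  rw [Framing.mem_group_mk_iff] at hg
  change g ∈ 𝔉.fU.group _
  rw [Framing.mem_group_mk_iff, 𝔉.fU_eq]
  exact hg.mono Set.inter_subset_left

/-- The framing of `V` is shifted against that of `U ∩ V`, so an edge group enters the `V` side only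
after conjugation. -/
theorem edge_mem_right (x : (U ∩ V : Set X)) {g : FundamentalGroup X x₀}
    (hg : g ∈ 𝔉.fW.group (ZerothHomotopy.mk x)) :
    (𝔉.shift (ZerothHomotopy.mk x))⁻¹ * g * 𝔉.shift (ZerothHomotopy.mk x) ∈
      𝔉.vertexSubgroup (Sum.inr (ZerothHomotopy.mk ⟨x, x.2.2⟩)) := by
  rw [Framing.mem_group_mk_iff] at hg
  change _ ∈ 𝔉.fV.group _
  rw [Framing.mem_group_mk_iff, 𝔉.fV_eq]
  simp only [FundamentalGroup.mul_eq_comp, FundamentalGroup.inv_eq_inv]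
  simpa using hg.mono Set.inter_subset_right

/-- The graph of groups of a cover by two sets: vertices are the path components of the two sets,
edges are the path components of the intersection. -/
noncomputable def graph : GraphOfGroups.{u} where
  V := ZerothHomotopy U ⊕ ZerothHomotopy V
  E := ZerothHomotopy (U ∩ V : Set X)
  src e := Sum.inl (ZerothHomotopy.mk ⟨e.rep, e.rep.2.1⟩)
  tgt e := Sum.inr (ZerothHomotopy.mk ⟨e.rep, e.rep.2.2⟩)
  -- Subgroups of Γ, rather than fundamental groups of components, make the edge maps injective.
  vGroup v := 𝔉.vertexSubgroup v
  eGroup e := 𝔉.fW.group e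
  srcHom e := Subgroup.inclusion fun g hg =>
    𝔉.edge_mem_left e.rep (by rwa [ZerothHomotopy.mk_rep])
  tgtHom e := ((MulAut.conj (𝔉.shift e)⁻¹).toMonoidHom.comp
    (𝔉.fW.group e).subtype).codRestrict _ fun g => by
      have h := 𝔉.edge_mem_right e.rep (g := g) (by rw [ZerothHomotopy.mk_rep]; exact g.2)
      rw [ZerothHomotopy.mk_rep] at h
      simpa using h
  srcHom_injective e := Subgroup.inclusion_injective _
  tgtHom_injective e := by
    intro a b hab
    have h := congrArg Subtype.val hab
    exact Subtype.ext ((MulAut.conj (𝔉.shift e)⁻¹).injective h)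

theorem coe_tgtHom (e : ZerothHomotopy (U ∩ V : Set X)) (a : 𝔉.fW.group e) :
    (𝔉.vertexSubgroup (𝔉.graph.tgt e)).subtype (𝔉.graph.tgtHom e a) =
      (𝔉.shift e)⁻¹ * a * 𝔉.shift e := by
  change (𝔉.shift e)⁻¹ * a * ((𝔉.shift e)⁻¹)⁻¹ = _
  rw [inv_inv]

theorem coe_srcHom (e : ZerothHomotopy (U ∩ V : Set X)) (a : 𝔉.fW.group e) :
    (𝔉.vertexSubgroup (𝔉.graph.src e)).subtype (𝔉.graph.srcHom e a) = a := rfl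

/-- The homomorphism from a vertex group to the path group. -/
noncomputable def vertexMap (v : ZerothHomotopy U ⊕ ZerothHomotopy V) :
    𝔉.vertexSubgroup v →* 𝔉.graph.PathGroup :=
  𝔉.graph.ofVertex v

/-- The element of the path group given by an element of a vertex group. -/
noncomputable def ofV (v : ZerothHomotopy U ⊕ ZerothHomotopy V) (g : FundamentalGroup X x₀) :
    𝔉.graph.PathGroup :=
  open scoped Classical in
  if h : g ∈ 𝔉.vertexSubgroup v then 𝔉.vertexMap v ⟨g, h⟩ else 1

theorem ofV_of_mem {v : ZerothHomotopy U ⊕ ZerothHomotopy V} {g : FundamentalGroup X x₀}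
    (h : g ∈ 𝔉.vertexSubgroup v) : 𝔉.ofV v g = 𝔉.vertexMap v ⟨g, h⟩ := dif_pos h

theorem ofV_coe (v : ZerothHomotopy U ⊕ ZerothHomotopy V) (g : 𝔉.vertexSubgroup v) :
    𝔉.ofV v g = 𝔉.vertexMap v g := 𝔉.ofV_of_mem g.2

theorem ofV_one (v : ZerothHomotopy U ⊕ ZerothHomotopy V) : 𝔉.ofV v 1 = 1 := by
  rw [𝔉.ofV_of_mem (one_mem _)]
  exact map_one (𝔉.vertexMap v)

theorem ofV_mul {v : ZerothHomotopy U ⊕ ZerothHomotopy V} {g h : FundamentalGroup X x₀}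
    (hg : g ∈ 𝔉.vertexSubgroup v) (hh : h ∈ 𝔉.vertexSubgroup v) :
    𝔉.ofV v (g * h) = 𝔉.ofV v g * 𝔉.ofV v h := by
  rw [𝔉.ofV_of_mem hg, 𝔉.ofV_of_mem hh, 𝔉.ofV_of_mem (mul_mem hg hh)]
  exact map_mul (𝔉.vertexMap v) ⟨g, hg⟩ ⟨h, hh⟩

theorem isPath_ofV (v : ZerothHomotopy U ⊕ ZerothHomotopy V) (g : FundamentalGroup X x₀) :
    𝔉.graph.IsPath v v (𝔉.ofV v g) := by
  by_cases h : g ∈ 𝔉.vertexSubgroup v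
  · rw [𝔉.ofV_of_mem h]
    exact .vertex _ _
  · rw [ofV, dif_neg h, ← map_one (𝔉.vertexMap v)]
    exact .vertex _ _

/-- The homomorphism from the free product to the fundamental group of the space. -/
noncomputable def freeProdMap : 𝔉.graph.FreeProd →* FundamentalGroup X x₀ :=
  Monoid.Coprod.lift
    (Monoid.CoprodI.lift (M := 𝔉.graph.vGroup) fun v => (𝔉.vertexSubgroup v).subtype)
    (FreeGroup.lift 𝔉.shift)

theorem freeProdMap_inl (v : 𝔉.graph.V) (g : 𝔉.graph.vGroup v) :
    𝔉.freeProdMap (Monoid.Coprod.inl (Monoid.CoprodI.of g)) =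
      (𝔉.vertexSubgroup v).subtype g := by
  rw [freeProdMap, Monoid.Coprod.lift_apply_inl]
  exact Monoid.CoprodI.lift_of _ _

theorem freeProdMap_inr (e : 𝔉.graph.E) :
    𝔉.freeProdMap (Monoid.Coprod.inr (FreeGroup.of e)) = 𝔉.shift e := by
  rw [freeProdMap, Monoid.Coprod.lift_apply_inr]
  exact FreeGroup.lift_apply_of

theorem relators_subset_ker : Subgroup.normalClosure 𝔉.graph.relators ≤ 𝔉.freeProdMap.ker := by
  refine Subgroup.normalClosure_le_normal ?_
  rintro _ ⟨e, a, rfl⟩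
  rw [SetLike.mem_coe, MonoidHom.mem_ker, map_mul, map_mul, map_mul, map_inv, map_inv,
    freeProdMap_inr, freeProdMap_inl, freeProdMap_inl]
  have h1 := 𝔉.coe_tgtHom e a
  have h2 := 𝔉.coe_srcHom e a
  rw [h1, h2]
  group

/-- The homomorphism from the path group to the fundamental group of the space. -/
noncomputable def toFundamentalGroup : 𝔉.graph.PathGroup →* FundamentalGroup X x₀ :=
  QuotientGroup.lift (Subgroup.normalClosure 𝔉.graph.relators) 𝔉.freeProdMap
    𝔉.relators_subset_ker

theorem toFundamentalGroup_ofVertex (v : 𝔉.graph.V) (g : 𝔉.graph.vGroup v) :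
    𝔉.toFundamentalGroup (𝔉.graph.ofVertex v g) =
      (𝔉.vertexSubgroup v).subtype g :=
  𝔉.freeProdMap_inl v g

theorem toFundamentalGroup_ofEdge (e : ZerothHomotopy (U ∩ V : Set X)) :
    𝔉.toFundamentalGroup (𝔉.graph.ofEdge e) = 𝔉.shift e :=
  𝔉.freeProdMap_inr e

theorem toFundamentalGroup_ofV {v : ZerothHomotopy U ⊕ ZerothHomotopy V}
    {g : FundamentalGroup X x₀} (hg : g ∈ 𝔉.vertexSubgroup v) :
    𝔉.toFundamentalGroup (𝔉.ofV v g) = g := by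
  rw [𝔉.ofV_of_mem hg]
  exact 𝔉.toFundamentalGroup_ofVertex v ⟨g, hg⟩

theorem src_mk (x : (U ∩ V : Set X)) :
    𝔉.graph.src (ZerothHomotopy.mk x) = Sum.inl (ZerothHomotopy.mk ⟨x, x.2.1⟩) := by
  obtain ⟨a, ha⟩ := exists_inSet_of_component_eq (ZerothHomotopy.mk_rep (ZerothHomotopy.mk x))
  exact congrArg Sum.inl (InSet.component_eq (A := U)
    (x := ⟨_, (ZerothHomotopy.mk x).rep.2.1⟩) (y := ⟨x, x.2.1⟩) (ha.mono Set.inter_subset_left))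

theorem tgt_mk (x : (U ∩ V : Set X)) :
    𝔉.graph.tgt (ZerothHomotopy.mk x) = Sum.inr (ZerothHomotopy.mk ⟨x, x.2.2⟩) := by
  obtain ⟨a, ha⟩ := exists_inSet_of_component_eq (ZerothHomotopy.mk_rep (ZerothHomotopy.mk x))
  exact congrArg Sum.inr (InSet.component_eq (A := V)
    (x := ⟨_, (ZerothHomotopy.mk x).rep.2.2⟩) (y := ⟨x, x.2.2⟩) (ha.mono Set.inter_subset_right))

/-- The edge relation, moved from the representative of the component to an arbitrary point `x`. -/
theorem ofV_edge (x : (U ∩ V : Set X)) {g : FundamentalGroup X x₀}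
    (hg : g ∈ 𝔉.fW.group (ZerothHomotopy.mk x)) :
    𝔉.ofV (Sum.inl (ZerothHomotopy.mk ⟨x, x.2.1⟩)) g =
      𝔉.graph.ofEdge (ZerothHomotopy.mk x) *
        𝔉.ofV (Sum.inr (ZerothHomotopy.mk ⟨x, x.2.2⟩))
          ((𝔉.shift (ZerothHomotopy.mk x))⁻¹ * g * 𝔉.shift (ZerothHomotopy.mk x)) *
        (𝔉.graph.ofEdge (ZerothHomotopy.mk x))⁻¹ := by
  have hs := 𝔉.src_mk x
  have ht := 𝔉.tgt_mk x
  set e := ZerothHomotopy.mk x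
  rw [← hs, ← ht]
  have h1 : 𝔉.ofV (𝔉.graph.src e) g = 𝔉.graph.ofVertex _ (𝔉.graph.srcHom e ⟨g, hg⟩) :=
    𝔉.ofV_coe _ (𝔉.graph.srcHom e ⟨g, hg⟩)
  have h2 : 𝔉.ofV (𝔉.graph.tgt e) ((𝔉.shift e)⁻¹ * g * 𝔉.shift e) =
      𝔉.graph.ofVertex _ (𝔉.graph.tgtHom e ⟨g, hg⟩) := by
    rw [← 𝔉.coe_tgtHom e ⟨g, hg⟩]
    exact 𝔉.ofV_coe _ (𝔉.graph.tgtHom e ⟨g, hg⟩)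
  rw [h1, h2]
  exact (𝔉.graph.ofEdge_conj e ⟨g, hg⟩).symm

/-- The letter by which the values of paths in `U` and in `V` are compared. -/
noncomputable def transition (x : V) : 𝔉.graph.PathGroup :=
  -- Outside `U` there is nothing to compare, and 1 is a trivial path at the vertex on the `V` side.
  open scoped Classical in
  if h : (x : X) ∈ U then 𝔉.graph.ofEdge (ZerothHomotopy.mk ⟨x, h, x.2⟩) else 1

theorem transition_of_mem (x : (U ∩ V : Set X)) :
    𝔉.transition ⟨x, x.2.2⟩ = 𝔉.graph.ofEdge (ZerothHomotopy.mk x) := dif_pos x.2.1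

/-- The value of a path class in `U`. -/
noncomputable def valU (x y : U)
    (a : FundamentalGroupoid.mk (x : X) ⟶ FundamentalGroupoid.mk (y : X)) : 𝔉.graph.PathGroup :=
  𝔉.ofV (Sum.inl (ZerothHomotopy.mk x)) (frameLoop (𝔉.fU.arrow x) a (𝔉.fU.arrow y))

/-- The value of a path class in `V`. -/
noncomputable def valV (x y : V)
    (a : FundamentalGroupoid.mk (x : X) ⟶ FundamentalGroupoid.mk (y : X)) : 𝔉.graph.PathGroup :=
  𝔉.transition y *
    𝔉.ofV (Sum.inr (ZerothHomotopy.mk x)) (frameLoop (𝔉.fV.arrow x) a (𝔉.fV.arrow y)) *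
    (𝔉.transition x)⁻¹

/-- The arrow at `y` cancels, and since all three points lie in one component the product is formed
in a single vertex group. -/
theorem valU_comp {x y z : U}
    {a : FundamentalGroupoid.mk (x : X) ⟶ FundamentalGroupoid.mk (y : X)}
    {b : FundamentalGroupoid.mk (y : X) ⟶ FundamentalGroupoid.mk (z : X)}
    (ha : InSet U a) (hb : InSet U b) :
    𝔉.valU x z (a ≫ b) = 𝔉.valU y z b * 𝔉.valU x y a := by
  have h2 := 𝔉.fU.frameLoop_mem_group hb
  rw [← ha.component_eq] at h2
  rw [valU, valU, valU, frameLoop_comp _ (𝔉.fU.arrow y), ← ha.component_eq]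
  exact 𝔉.ofV_mul (v := Sum.inl _) h2 (𝔉.fU.frameLoop_mem_group ha)

theorem valV_comp {x y z : V}
    {a : FundamentalGroupoid.mk (x : X) ⟶ FundamentalGroupoid.mk (y : X)}
    {b : FundamentalGroupoid.mk (y : X) ⟶ FundamentalGroupoid.mk (z : X)}
    (ha : InSet V a) (hb : InSet V b) :
    𝔉.valV x z (a ≫ b) = 𝔉.valV y z b * 𝔉.valV x y a := by
  have h2 := 𝔉.fV.frameLoop_mem_group hb
  rw [← ha.component_eq] at h2
  rw [valV, valV, valV, frameLoop_comp _ (𝔉.fV.arrow y), ← ha.component_eq,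
    𝔉.ofV_mul (v := Sum.inr _) h2 (𝔉.fV.frameLoop_mem_group ha)]
  group

/-- Both ends of `a` lie in one component of `U ∩ V` and carry the same edge letter. The shift
between the framings conjugates the loop, and the edge relation undoes this. -/
theorem valU_eq_valV (x y : (U ∩ V : Set X))
    {a : FundamentalGroupoid.mk (x : X) ⟶ FundamentalGroupoid.mk (y : X)}
    (ha : InSet (U ∩ V) a) :
    𝔉.valU ⟨x, x.2.1⟩ ⟨y, y.2.1⟩ a = 𝔉.valV ⟨x, x.2.2⟩ ⟨y, y.2.2⟩ a := by
  have hxy := ha.component_eq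
  rw [valU, valV, 𝔉.transition_of_mem, 𝔉.transition_of_mem, 𝔉.fU_eq, 𝔉.fU_eq, 𝔉.fV_eq,
    𝔉.fV_eq, ← hxy, 𝔉.ofV_edge x (𝔉.fW.frameLoop_mem_group ha), frameLoop_shift]

end CompatibleFramings

/-! ### Comparison of the fundamental groups -/

namespace CompatibleFramings

open CategoryTheory

variable {X : Type u} [TopologicalSpace X] {x₀ : X} {U V : Set X} (𝔉 : CompatibleFramings x₀ U V)

/-- The value of a path in `U` or in `V`. -/
noncomputable def pathVal ⦃x y : X⦄ (γ : Path x y) : 𝔉.graph.PathGroup :=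
  open scoped Classical in
  if h : ∀ t, γ t ∈ U then
    𝔉.valU ⟨x, by simpa using h 0⟩ ⟨y, by simpa using h 1⟩ (Path.Homotopic.Quotient.mk γ)
  else if h : ∀ t, γ t ∈ V then
    𝔉.valV ⟨x, by simpa using h 0⟩ ⟨y, by simpa using h 1⟩ (Path.Homotopic.Quotient.mk γ)
  else 1

theorem pathVal_left {x y : U} (γ : Path (x : X) (y : X)) (h : ∀ t, γ t ∈ U) :
    𝔉.pathVal γ = 𝔉.valU x y (Path.Homotopic.Quotient.mk γ) := dif_pos h

/-- `pathVal` gives preference to `U`; for paths in both sets the two values agree. -/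
theorem pathVal_right {x y : V} (γ : Path (x : X) (y : X)) (h : ∀ t, γ t ∈ V) :
    𝔉.pathVal γ = 𝔉.valV x y (Path.Homotopic.Quotient.mk γ) := by
  by_cases h' : ∀ t, γ t ∈ U
  · rw [pathVal, dif_pos h']
    exact 𝔉.valU_eq_valV ⟨x, by simpa using h' 0, x.2⟩ ⟨y, by simpa using h' 1, y.2⟩
      ⟨γ, fun t => ⟨h' t, h t⟩, rfl⟩
  · rw [pathVal, dif_neg h', dif_pos h]

theorem locallyMultiplicative_pathVal :
    LocallyMultiplicative (fun b : Bool => cond b U V) 𝔉.pathVal := by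
  intro b x y z γ₁ γ₂ γ₃ h₁ h₂ h₃ h
  have h' : FundamentalGroupoid.fromPath (Path.Homotopic.Quotient.mk γ₃) =
      FundamentalGroupoid.fromPath (Path.Homotopic.Quotient.mk γ₁) ≫
      FundamentalGroupoid.fromPath (Path.Homotopic.Quotient.mk γ₂) :=
    Path.Homotopic.Quotient.eq.2 h.symm
  cases b with
  | true =>
    have hx : x ∈ U := by simpa using h₁ 0
    have hy : y ∈ U := by simpa using h₁ 1
    have hz : z ∈ U := by simpa using h₂ 1
    rw [𝔉.pathVal_left (x := ⟨x, hx⟩) (y := ⟨z, hz⟩) γ₃ h₃,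
      𝔉.pathVal_left (x := ⟨x, hx⟩) (y := ⟨y, hy⟩) γ₁ h₁,
      𝔉.pathVal_left (x := ⟨y, hy⟩) (y := ⟨z, hz⟩) γ₂ h₂]
    exact (congrArg (𝔉.valU ⟨x, hx⟩ ⟨z, hz⟩) h').trans
      (𝔉.valU_comp (y := ⟨y, hy⟩) ⟨γ₁, h₁, rfl⟩ ⟨γ₂, h₂, rfl⟩)
  | false =>
    have hx : x ∈ V := by simpa using h₁ 0
    have hy : y ∈ V := by simpa using h₁ 1
    have hz : z ∈ V := by simpa using h₂ 1
    rw [𝔉.pathVal_right (x := ⟨x, hx⟩) (y := ⟨z, hz⟩) γ₃ h₃,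
      𝔉.pathVal_right (x := ⟨x, hx⟩) (y := ⟨y, hy⟩) γ₁ h₁,
      𝔉.pathVal_right (x := ⟨y, hy⟩) (y := ⟨z, hz⟩) γ₂ h₂]
    exact (congrArg (𝔉.valV ⟨x, hx⟩ ⟨z, hz⟩) h').trans
      (𝔉.valV_comp (y := ⟨y, hy⟩) ⟨γ₁, h₁, rfl⟩ ⟨γ₂, h₂, rfl⟩)

/-- An extension of the values of paths in `U` and in `V` to all path classes. -/
structure Extension where
  /-- the value of a path class -/
  toFun : ∀ {x y : X}, (FundamentalGroupoid.mk x ⟶ FundamentalGroupoid.mk y) → 𝔉.graph.PathGroup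
  map_comp : ∀ {x y z : X} (a : FundamentalGroupoid.mk x ⟶ FundamentalGroupoid.mk y)
    (b : FundamentalGroupoid.mk y ⟶ FundamentalGroupoid.mk z), toFun (a ≫ b) = toFun b * toFun a
  eq_valU : ∀ (x y : U) (a : FundamentalGroupoid.mk (x : X) ⟶ FundamentalGroupoid.mk (y : X)),
    InSet U a → toFun a = 𝔉.valU x y a
  eq_valV : ∀ (x y : V) (a : FundamentalGroupoid.mk (x : X) ⟶ FundamentalGroupoid.mk (y : X)),
    InSet V a → toFun a = 𝔉.valV x y a

theorem isOpen_cond (hU : IsOpen U) (hV : IsOpen V) (b : Bool) : IsOpen (cond b U V) := by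
  cases b
  · exact hV
  · exact hU

omit [TopologicalSpace X] in
theorem iUnion_cond (hUV : U ∪ V = Set.univ) : ⋃ b : Bool, cond b U V = Set.univ := by
  rw [← Set.union_eq_iUnion, hUV]

theorem exists_extension (hU : IsOpen U) (hV : IsOpen V) (hUV : U ∪ V = Set.univ) :
    Nonempty 𝔉.Extension := by
  obtain ⟨D, hD, hval⟩ := 𝔉.locallyMultiplicative_pathVal.exists_extension
    (isOpen_cond hU hV) (iUnion_cond hUV)
  refine ⟨⟨fun {x y} a => D (x := x) (y := y) a, fun a b => hD a b, ?_, ?_⟩⟩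
  · rintro x y _ ⟨γ, hγ, rfl⟩
    rw [← 𝔉.pathVal_left γ hγ]
    exact hval true γ hγ
  · rintro x y _ ⟨γ, hγ, rfl⟩
    rw [← 𝔉.pathVal_right γ hγ]
    exact hval false γ hγ

/-- The vertex of a point. -/
noncomputable def vertexAt (hUV : U ∪ V = Set.univ) (x : X) :
    ZerothHomotopy U ⊕ ZerothHomotopy V :=
  open scoped Classical in
  if h : x ∈ U then Sum.inl (ZerothHomotopy.mk ⟨x, h⟩)
  else Sum.inr (ZerothHomotopy.mk ⟨x, (hUV.symm ▸ Set.mem_univ x : x ∈ U ∪ V).resolve_left h⟩)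

/-- The path class from `x₀` to a point given by the framings. -/
noncomputable def arrowAt (hUV : U ∪ V = Set.univ) (x : X) :
    FundamentalGroupoid.mk x₀ ⟶ FundamentalGroupoid.mk x :=
  open scoped Classical in
  if h : x ∈ U then 𝔉.fU.arrow ⟨x, h⟩
  else 𝔉.fV.arrow ⟨x, (hUV.symm ▸ Set.mem_univ x : x ∈ U ∪ V).resolve_left h⟩

/-! ### The extended values and the two composites -/

section

variable (hUV : U ∪ V = Set.univ)

theorem vertexAt_left (x : U) : vertexAt hUV x = Sum.inl (ZerothHomotopy.mk x) := dif_pos x.2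

theorem arrowAt_left (x : U) : 𝔉.arrowAt hUV x = 𝔉.fU.arrow x := dif_pos x.2

theorem isPath_transition (x : V) :
    𝔉.graph.IsPath (vertexAt hUV x) (Sum.inr (ZerothHomotopy.mk x)) (𝔉.transition x) := by
  by_cases h : (x : X) ∈ U
  · have h1 := GraphOfGroups.IsPath.edge (𝒢 := 𝔉.graph) (ZerothHomotopy.mk ⟨x, h, x.2⟩)
    rw [src_mk, tgt_mk] at h1
    rw [transition, dif_pos h, vertexAt, dif_pos h]
    exact h1
  · rw [transition, dif_neg h, vertexAt, dif_neg h, ← 𝔉.ofV_one (Sum.inr (ZerothHomotopy.mk x))]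
    exact 𝔉.isPath_ofV _ _

theorem toFundamentalGroup_transition (x : V) :
    𝔉.fV.arrow x = 𝔉.toFundamentalGroup (𝔉.transition x) ≫ 𝔉.arrowAt hUV x := by
  by_cases h : (x : X) ∈ U
  · rw [transition, dif_pos h, arrowAt, dif_pos h, toFundamentalGroup_ofEdge]
    exact (𝔉.fV_eq ⟨x, h, x.2⟩).trans (congrArg _ (𝔉.fU_eq ⟨x, h, x.2⟩).symm)
  · rw [transition, dif_neg h, arrowAt, dif_neg h, map_one]
    exact (Category.id_comp _).symm

theorem toFundamentalGroup_valU (x y : U)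
    {a : FundamentalGroupoid.mk (x : X) ⟶ FundamentalGroupoid.mk (y : X)} (ha : InSet U a) :
    𝔉.toFundamentalGroup (𝔉.valU x y a) =
      frameLoop (𝔉.arrowAt hUV x) a (𝔉.arrowAt hUV y) := by
  rw [arrowAt_left, arrowAt_left]
  exact 𝔉.toFundamentalGroup_ofV (v := Sum.inl _) (𝔉.fU.frameLoop_mem_group ha)

theorem toFundamentalGroup_valV (x y : V)
    {a : FundamentalGroupoid.mk (x : X) ⟶ FundamentalGroupoid.mk (y : X)} (ha : InSet V a) :
    𝔉.toFundamentalGroup (𝔉.valV x y a) =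
      frameLoop (𝔉.arrowAt hUV x) a (𝔉.arrowAt hUV y) := by
  rw [valV, map_mul, map_mul, map_inv,
    𝔉.toFundamentalGroup_ofV (v := Sum.inr _) (𝔉.fV.frameLoop_mem_group ha),
    𝔉.toFundamentalGroup_transition hUV x, 𝔉.toFundamentalGroup_transition hUV y]
  simp only [FundamentalGroup.mul_eq_comp, FundamentalGroup.inv_eq_inv, frameLoop]
  simp

variable {𝔉}

namespace Extension

variable (D : 𝔉.Extension)

include hUV in
theorem induction (hU : IsOpen U) (hV : IsOpen V)
    {Q : ∀ ⦃x y : X⦄, (FundamentalGroupoid.mk x ⟶ FundamentalGroupoid.mk y) → Prop}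
    (left : ∀ (x y : U) (a : FundamentalGroupoid.mk (x : X) ⟶ FundamentalGroupoid.mk (y : X)),
      InSet U a → Q a)
    (right : ∀ (x y : V) (a : FundamentalGroupoid.mk (x : X) ⟶ FundamentalGroupoid.mk (y : X)),
      InSet V a → Q a)
    (comp : ∀ {x y z : X} (a : FundamentalGroupoid.mk x ⟶ FundamentalGroupoid.mk y)
      (b : FundamentalGroupoid.mk y ⟶ FundamentalGroupoid.mk z), Q a → Q b → Q (a ≫ b))
    {x y : X} (a : FundamentalGroupoid.mk x ⟶ FundamentalGroupoid.mk y) : Q a := by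
  refine pathClass_induction (isOpen_cond hU hV) (iUnion_cond hUV)
    (Q := fun x y a => Q (x := x) (y := y) a) ?_ (fun a b ha hb => comp a b ha hb) a
  intro b x y γ hγ
  cases b with
  | true => exact left ⟨x, by simpa using hγ 0⟩ ⟨y, by simpa using hγ 1⟩ _ ⟨γ, hγ, rfl⟩
  | false => exact right ⟨x, by simpa using hγ 0⟩ ⟨y, by simpa using hγ 1⟩ _ ⟨γ, hγ, rfl⟩

/-- The direction is reversed because values multiply in the order opposite to path composition. -/
theorem isPath (hU : IsOpen U) (hV : IsOpen V) {x y : X}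
    (a : FundamentalGroupoid.mk x ⟶ FundamentalGroupoid.mk y) :
    𝔉.graph.IsPath (vertexAt hUV y) (vertexAt hUV x) (D.toFun a) := by
  refine induction hUV hU hV
    (Q := fun x y a => 𝔉.graph.IsPath (vertexAt hUV y) (vertexAt hUV x) (D.toFun a))
    (fun x y a ha => ?_) (fun x y a ha => ?_) (fun a b ha hb => ?_) a
  · rw [D.eq_valU x y a ha, vertexAt_left, vertexAt_left, ha.component_eq, valU, ha.component_eq]
    exact 𝔉.isPath_ofV _ _
  · rw [D.eq_valV x y a ha, valV]
    refine ((𝔉.isPath_transition hUV y).comp ?_).comp (𝔉.isPath_transition hUV x).inv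
    rw [ha.component_eq]
    exact 𝔉.isPath_ofV _ _
  · rw [D.map_comp]
    exact hb.comp ha

/-- Both sides are compatible with composition, so paths inside `U` or `V` suffice. -/
theorem toFundamentalGroup_eq (hU : IsOpen U) (hV : IsOpen V) {x y : X}
    (a : FundamentalGroupoid.mk x ⟶ FundamentalGroupoid.mk y) :
    𝔉.toFundamentalGroup (D.toFun a) = frameLoop (𝔉.arrowAt hUV x) a (𝔉.arrowAt hUV y) := by
  refine induction hUV hU hV
    (Q := fun x y a => 𝔉.toFundamentalGroup (D.toFun a) =
      frameLoop (𝔉.arrowAt hUV x) a (𝔉.arrowAt hUV y))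
    (fun x y a ha => ?_) (fun x y a ha => ?_) (fun {x y z} a b ha hb => ?_) a
  · rw [D.eq_valU x y a ha, 𝔉.toFundamentalGroup_valU hUV x y ha]
  · rw [D.eq_valV x y a ha, 𝔉.toFundamentalGroup_valV hUV x y ha]
  · rw [D.map_comp, map_mul, ha, hb, ← frameLoop_comp]

theorem map_frameLoop {x y : X} (f : FundamentalGroupoid.mk x₀ ⟶ FundamentalGroupoid.mk x)
    (a : FundamentalGroupoid.mk x ⟶ FundamentalGroupoid.mk y)
    (g : FundamentalGroupoid.mk x₀ ⟶ FundamentalGroupoid.mk y) :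
    D.toFun (x := x₀) (y := x₀) (frameLoop f a g) =
      (D.toFun g)⁻¹ * D.toFun a * D.toFun f := by
  rw [mul_assoc, eq_inv_mul_iff_mul_eq, ← D.map_comp, ← D.map_comp]
  congr 1
  simp [frameLoop]

/-- The extension on loops at the base point. -/
noncomputable def loopHom : FundamentalGroup X x₀ →* 𝔉.graph.PathGroup :=
  MonoidHom.mk' (fun g => D.toFun (x := x₀) (y := x₀) g) fun g h => D.map_comp h g

/-- Elements comparing `loopHom` with the canonical maps of the vertex groups. -/
noncomputable def corner : ZerothHomotopy U ⊕ ZerothHomotopy V → 𝔉.graph.PathGroup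
  | Sum.inl i => (D.toFun (𝔉.fU.arrow i.rep))⁻¹
  | Sum.inr j => (D.toFun (𝔉.fV.arrow j.rep))⁻¹ * 𝔉.transition j.rep

/-- The class joining the arrows at `x` and at the representative has trivial frame loop, hence
value 1. -/
theorem corner_inl (x : U) :
    D.corner (Sum.inl (ZerothHomotopy.mk x)) = (D.toFun (𝔉.fU.arrow x))⁻¹ := by
  have h := 𝔉.fU.compat x (ZerothHomotopy.mk x).rep (ZerothHomotopy.mk_rep _).symm
  have h1 := D.eq_valU _ _ _ h
  rw [valU, frameLoop_inv_comp, ofV_one] at h1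
  have h2 := D.map_comp (𝔉.fU.arrow x) (inv (𝔉.fU.arrow x) ≫ 𝔉.fU.arrow (ZerothHomotopy.mk x).rep)
  rw [h1, one_mul, IsIso.hom_inv_id_assoc] at h2
  rw [corner, h2]

/-- Here the joining class has value `transition rep * (transition x)⁻¹`, which the second factor of
`corner` absorbs. -/
theorem corner_inr (x : V) :
    D.corner (Sum.inr (ZerothHomotopy.mk x)) =
      (D.toFun (𝔉.fV.arrow x))⁻¹ * 𝔉.transition x := by
  have h := 𝔉.fV.compat x (ZerothHomotopy.mk x).rep (ZerothHomotopy.mk_rep _).symm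
  have h1 := D.eq_valV _ _ _ h
  rw [valV, frameLoop_inv_comp, ofV_one] at h1
  have h2 := D.map_comp (𝔉.fV.arrow x) (inv (𝔉.fV.arrow x) ≫ 𝔉.fV.arrow (ZerothHomotopy.mk x).rep)
  rw [h1, IsIso.hom_inv_id_assoc] at h2
  rw [corner, h2]
  group

/-- `g` is the frame loop of a class inside the component, whose value is known; the arrows to and
from it contribute the corners. -/
theorem loopHom_of_mem (v : ZerothHomotopy U ⊕ ZerothHomotopy V) {g : FundamentalGroup X x₀}
    (hg : g ∈ 𝔉.vertexSubgroup v) :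
    D.loopHom g = D.corner v * 𝔉.ofV v g * (D.corner v)⁻¹ := by
  have key : ∀ {x : X} (f : FundamentalGroupoid.mk x₀ ⟶ FundamentalGroupoid.mk x),
      frameLoop f (inv f ≫ g ≫ f) f = g := by
    intro x f
    simp [frameLoop]
  rcases v with i | j
  · have hg' : InSet U (inv (𝔉.fU.arrow i.rep) ≫ g ≫ 𝔉.fU.arrow i.rep) := hg
    have h := D.map_frameLoop (𝔉.fU.arrow i.rep) (inv (𝔉.fU.arrow i.rep) ≫ g ≫ 𝔉.fU.arrow i.rep)
      (𝔉.fU.arrow i.rep)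
    rw [D.eq_valU _ _ _ hg', valU, key, ZerothHomotopy.mk_rep] at h
    rw [corner, inv_inv]
    exact h
  · have hg' : InSet V (inv (𝔉.fV.arrow j.rep) ≫ g ≫ 𝔉.fV.arrow j.rep) := hg
    have h := D.map_frameLoop (𝔉.fV.arrow j.rep) (inv (𝔉.fV.arrow j.rep) ≫ g ≫ 𝔉.fV.arrow j.rep)
      (𝔉.fV.arrow j.rep)
    rw [D.eq_valV _ _ _ hg', valV, key, ZerothHomotopy.mk_rep] at h
    rw [corner, mul_inv_rev, inv_inv]
    refine h.trans ?_
    group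

theorem loopHom_coe (v : ZerothHomotopy U ⊕ ZerothHomotopy V) (g : 𝔉.vertexSubgroup v) :
    D.loopHom ((𝔉.vertexSubgroup v).subtype g) =
      D.corner v * 𝔉.vertexMap v g * (D.corner v)⁻¹ := by
  rw [Subgroup.subtype_apply, D.loopHom_of_mem v g.2, ofV_coe]

/-- The shift compares the two framing arrows at a point of `U ∩ V`, so its value is a quotient of
theirs. -/
theorem loopHom_shift (e : ZerothHomotopy (U ∩ V : Set X)) :
    D.loopHom (𝔉.shift e) =
      D.corner (𝔉.graph.src e) * 𝔉.graph.ofEdge e * (D.corner (𝔉.graph.tgt e))⁻¹ := by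
  obtain ⟨x, rfl⟩ : ∃ x, ZerothHomotopy.mk x = e := ⟨e.rep, e.mk_rep⟩
  have h := D.map_comp (𝔉.shift (ZerothHomotopy.mk x)) (𝔉.fW.arrow x)
  rw [← 𝔉.fV_eq, ← 𝔉.fU_eq] at h
  rw [src_mk, tgt_mk, corner_inl, corner_inr, transition_of_mem, h]
  change D.toFun (x := x₀) (y := x₀) _ = _
  group

/-- Corners telescope along a path in the graph, so the generators decide. For `v = w` the right
side is a conjugate of `z`. -/
theorem loopHom_toFundamentalGroup {v w : 𝔉.graph.V} {z : 𝔉.graph.PathGroup}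
    (hz : 𝔉.graph.IsPath v w z) :
    D.loopHom (𝔉.toFundamentalGroup z) = D.corner v * z * (D.corner w)⁻¹ := by
  induction hz with
  | vertex v g =>
    rw [toFundamentalGroup_ofVertex]
    exact D.loopHom_coe v g
  | edge e => exact (congrArg _ (𝔉.toFundamentalGroup_ofEdge e)).trans (D.loopHom_shift e)
  | edgeInv e =>
    have h := (congrArg D.loopHom (𝔉.toFundamentalGroup_ofEdge e)).trans (D.loopHom_shift e)
    rw [map_inv, map_inv, h]
    group
  | comp _ _ h1 h2 =>
    rw [map_mul, map_mul, h1, h2]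
    group

end Extension

end

end CompatibleFramings

/-! ### The isomorphism -/

namespace CompatibleFramings

open CategoryTheory

variable {X : Type u} [TopologicalSpace X] {x₀ : X} {U V : Set X} (𝔉 : CompatibleFramings x₀ U V)

theorem graph_connected (hU : IsOpen U) (hV : IsOpen V) (hUV : U ∪ V = Set.univ)
    [PathConnectedSpace X] : 𝔉.graph.Connected := by
  obtain ⟨D⟩ := 𝔉.exists_extension hU hV hUV
  let R : 𝔉.graph.V → 𝔉.graph.V → Prop :=
    Relation.EqvGen (fun a b => ∃ e : 𝔉.graph.E, 𝔉.graph.src e = a ∧ 𝔉.graph.tgt e = b)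
  have hR : ∀ {v w z}, 𝔉.graph.IsPath v w z → R v w := by
    intro v w z h
    induction h with
    | vertex v g => exact .refl _
    | edge e => exact .rel _ _ ⟨e, rfl, rfl⟩
    | edgeInv e => exact .symm _ _ (.rel _ _ ⟨e, rfl, rfl⟩)
    | comp _ _ h1 h2 => exact .trans _ _ _ h1 h2
  have hpt : ∀ x y : X, R (vertexAt hUV x) (vertexAt hUV y) := fun x y =>
    hR (D.isPath hUV hU hV (x := y) (y := x)
      (Path.Homotopic.Quotient.mk (PathConnectedSpace.somePath y x)))
  have hv : ∀ v : 𝔉.graph.V, ∃ x : X, R (vertexAt hUV x) v := by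
    rintro (i | j)
    · refine ⟨i.rep, ?_⟩
      rw [vertexAt_left, ZerothHomotopy.mk_rep]
      exact .refl _
    -- The representative may lie in `U`, and then `vertexAt` is the vertex on the `U` side; the
    -- transition edge leads to `j`.
    · refine ⟨j.rep, ?_⟩
      have h := hR (𝔉.isPath_transition hUV j.rep)
      rwa [ZerothHomotopy.mk_rep] at h
  refine ⟨⟨vertexAt hUV x₀⟩, fun v w => ?_⟩
  obtain ⟨x, hx⟩ := hv v
  obtain ⟨y, hy⟩ := hv w
  exact .trans _ _ _ (.symm _ _ hx) (.trans _ _ _ (hpt x y) hy)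

theorem bijective_toFundamentalGroup (hU : IsOpen U) (hV : IsOpen V) (hUV : U ∪ V = Set.univ) :
    Function.Bijective (𝔉.toFundamentalGroup.comp
      (𝔉.graph.fundamentalGroup (vertexAt hUV x₀)).subtype) := by
  obtain ⟨D⟩ := 𝔉.exists_extension hU hV hUV
  constructor
  · rw [injective_iff_map_eq_one]
    rintro ⟨z, hz⟩ h
    have h1 := D.loopHom_toFundamentalGroup hz
    have h2 : 𝔉.toFundamentalGroup z = 1 := h
    rw [h2, map_one, eq_comm, mul_inv_eq_one, mul_eq_left] at h1
    exact Subtype.ext h1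
  · intro g
    -- The arrow at `x₀` need not be trivial; conjugating by it makes the frame loop of `a` equal to
    -- `g`.
    let a : FundamentalGroupoid.mk x₀ ⟶ FundamentalGroupoid.mk x₀ :=
      inv (𝔉.arrowAt hUV x₀) ≫ g ≫ 𝔉.arrowAt hUV x₀
    refine ⟨⟨D.toFun a, D.isPath hUV hU hV a⟩, ?_⟩
    refine (D.toFundamentalGroup_eq hUV hU hV a).trans ?_
    simp [frameLoop, a]

/-- The fundamental group of the graph of groups is the fundamental group of the space. -/
noncomputable def fundamentalGroupEquiv (hU : IsOpen U) (hV : IsOpen V)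
    (hUV : U ∪ V = Set.univ) :
    𝔉.graph.fundamentalGroup (vertexAt hUV x₀) ≃* FundamentalGroup X x₀ :=
  MulEquiv.ofBijective _ (𝔉.bijective_toFundamentalGroup hU hV hUV)

theorem fundamentalGroupEquiv_vertexHom (hU : IsOpen U) (hV : IsOpen V)
    (hUV : U ∪ V = Set.univ) {v : 𝔉.graph.V} {p : 𝔉.graph.PathGroup}
    (hp : 𝔉.graph.IsPath (vertexAt hUV x₀) v p) (g : 𝔉.graph.vGroup v) :
    𝔉.fundamentalGroupEquiv hU hV hUV (GraphOfGroups.vertexHom hp g) =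
      MulAut.conj (𝔉.toFundamentalGroup p) ((𝔉.vertexSubgroup v).subtype g) := by
  have h : 𝔉.fundamentalGroupEquiv hU hV hUV (GraphOfGroups.vertexHom hp g) =
      𝔉.toFundamentalGroup (p * 𝔉.graph.ofVertex v g * p⁻¹) := rfl
  rw [h, map_mul, map_mul, map_inv, toFundamentalGroup_ofVertex]
  rfl

theorem vertexHom_injective (hU : IsOpen U) (hV : IsOpen V)
    (hUV : U ∪ V = Set.univ) {v : 𝔉.graph.V} {p : 𝔉.graph.PathGroup}
    (hp : 𝔉.graph.IsPath (vertexAt hUV x₀) v p) :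
    Function.Injective (GraphOfGroups.vertexHom hp) := by
  intro g h hgh
  have h1 := congrArg (𝔉.fundamentalGroupEquiv hU hV hUV) hgh
  rw [fundamentalGroupEquiv_vertexHom, fundamentalGroupEquiv_vertexHom] at h1
  exact (𝔉.vertexSubgroup v).subtype_injective ((MulAut.conj _).injective h1)

theorem map_range_vertexHom (hU : IsOpen U) (hV : IsOpen V)
    (hUV : U ∪ V = Set.univ) {v : 𝔉.graph.V} {p : 𝔉.graph.PathGroup}
    (hp : 𝔉.graph.IsPath (vertexAt hUV x₀) v p) :
    (GraphOfGroups.vertexHom hp).range.map (𝔉.fundamentalGroupEquiv hU hV hUV).toMonoidHom =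
      (𝔉.vertexSubgroup v).map (MulAut.conj (𝔉.toFundamentalGroup p)).toMonoidHom := by
  ext g
  constructor
  · rintro ⟨_, ⟨h, rfl⟩, rfl⟩
    exact ⟨(𝔉.vertexSubgroup v).subtype h, Subtype.prop (p := (· ∈ 𝔉.vertexSubgroup v)) h,
      (𝔉.fundamentalGroupEquiv_vertexHom hU hV hUV hp h).symm⟩
  · rintro ⟨h, hh, rfl⟩
    exact ⟨_, ⟨(⟨h, hh⟩ : 𝔉.vertexSubgroup v), rfl⟩,
      𝔉.fundamentalGroupEquiv_vertexHom hU hV hUV hp (⟨h, hh⟩ : 𝔉.vertexSubgroup v)⟩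

end CompatibleFramings

/-! ### CW-complexes, amenable groups and covers -/

/-- Closed cells are path-connected, so a union of path components contains or misses each of them
and is closed in the weak topology. Path components are therefore clopen. -/
theorem Topology.CWComplex.pathConnectedSpace {X : Type*} [TopologicalSpace X] [T2Space X]
    [Topology.CWComplex (Set.univ : Set X)] [ConnectedSpace X] : PathConnectedSpace X := by
  have hcell : ∀ (n : ℕ) (e : RelCWComplex.cell (Set.univ : Set X) n) (x y : X),
      x ∈ RelCWComplex.closedCell n e → y ∈ RelCWComplex.closedCell n e → Joined x y := by
    intro n e x y hx hy
    have h : IsPathConnected (RelCWComplex.closedCell (C := (Set.univ : Set X)) n e) :=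
      ((convex_closedBall (0 : Fin n → ℝ) 1).isPathConnected
        ⟨0, Metric.mem_closedBall_self zero_le_one⟩).image'
        (RelCWComplex.continuousOn (C := (Set.univ : Set X)) n e)
    exact (h.joinedIn x hx y hy).joined
  have hclosed : ∀ (A : Set X), (∀ x y, Joined x y → x ∈ A → y ∈ A) → IsClosed A := by
    intro A hA
    rw [CWComplex.closed (Set.univ : Set X) A (Set.subset_univ _)]
    intro n e
    by_cases h : ∃ x ∈ RelCWComplex.closedCell (C := (Set.univ : Set X)) n e, x ∈ A
    · obtain ⟨x, hx, hxA⟩ := h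
      rw [Set.inter_eq_right.2 fun y hy => hA x y (hcell n e x y hx hy) hxA]
      exact RelCWComplex.isClosed_closedCell
    · push Not at h
      rw [Set.disjoint_iff_inter_eq_empty.1 (Set.disjoint_left.2 fun x hx hx' => h x hx' hx)]
      exact isClosed_empty
  refine ⟨inferInstance, fun x y => ?_⟩
  have h1 : IsClosed (pathComponent x) := hclosed _ fun a b hab ha => Joined.trans ha hab
  have h2 : IsClosed (pathComponent x)ᶜ := hclosed _ fun a b hab ha hb =>
    ha (Joined.trans hb hab.symm)
  have h3 : pathComponent x = Set.univ :=
    IsClopen.eq_univ ⟨h1, isClosed_compl_iff.1 h2⟩ ⟨x, mem_pathComponent_self x⟩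
  have h4 : y ∈ pathComponent x := h3 ▸ Set.mem_univ y
  exact h4

/-- A group that embeds into an amenable group is amenable. -/
theorem IsAmenable.of_injective {G H : Type u} [Group G] [Group H] (hG : IsAmenable G)
    (f : H →* G) (hf : Function.Injective f) : IsAmenable H := by
  obtain ⟨μ, h1, hadd, hinv⟩ := hG
  -- Each element of `G` is uniquely a product of an element of `f.range` and one of a transversal;
  -- keeping the first factor is an `H`-equivariant map, along which the measure is pushed forward.
  obtain ⟨π, hπ⟩ : ∃ π : G → H, ∀ h g, π (f h * g) = h * π g := by
    obtain ⟨T, hT, -⟩ := f.range.exists_isComplement_right 1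
    refine ⟨fun g => (MonoidHom.ofInjective hf).symm (hT.equiv g).1, fun h g => ?_⟩
    have := hT.equiv_mul_left ⟨f h, h, rfl⟩ g
    beta_reduce
    rw [this, map_mul]
    congr 1
    rw [MulEquiv.symm_apply_eq]
    rfl
  refine ⟨fun A => μ (π ⁻¹' A), by simpa using h1, fun A B hAB => ?_, fun h A => ?_⟩
  · beta_reduce
    rw [Set.preimage_union]
    exact hadd _ _ (hAB.preimage π)
  · beta_reduce
    rw [← hinv (f h) (π ⁻¹' A)]
    congr 1
    ext g
    constructor
    · rintro ⟨a, ha, hag⟩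
      refine ⟨f h⁻¹ * g, ?_, by rw [map_inv]; simp⟩
      rw [Set.mem_preimage, hπ, ← hag]
      simpa using ha
    · rintro ⟨g', hg', rfl⟩
      exact ⟨π g', hg', (hπ h g').symm⟩

theorem exists_cover_of_coverCat_le_two {X : Type u} [TopologicalSpace X] {P : Set X → Prop}
    (h : coverCat P ≤ 2) :
    ∃ U V : Set X, IsOpen U ∧ IsOpen V ∧ U ∪ V = Set.univ ∧ P U ∧ P V := by
  have hne : {n : ℕ∞ | 1 ≤ n ∧ ∃ 𝒰 : Set (Set X), 𝒰.encard = n ∧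
      (∀ U ∈ 𝒰, IsOpen U ∧ P U) ∧ ⋃₀ 𝒰 = Set.univ}.Nonempty := by
    by_contra hne
    rw [Set.not_nonempty_iff_eq_empty] at hne
    rw [coverCat, hne, sInf_empty] at h
    exact absurd h (by decide)
  -- A non-empty set in `ℕ∞` attains its infimum, so an actual cover is obtained.
  obtain ⟨h1, 𝒰, h𝒰, hP, hcov⟩ := csInf_mem hne
  change sInf _ ≤ 2 at h
  rw [← h𝒰] at h h1
  obtain ⟨U, hU⟩ := Set.one_le_encard_iff_nonempty.1 h1
  by_cases hs : ∃ V ∈ 𝒰, V ≠ U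
  · obtain ⟨V, hV, hVU⟩ := hs
    refine ⟨U, V, (hP U hU).1, (hP V hV).1, ?_, (hP U hU).2, (hP V hV).2⟩
    have hsub : ({U, V} : Set (Set X)) ⊆ 𝒰 := by
      rintro W (rfl | rfl) <;> assumption
    have heq : ({U, V} : Set (Set X)) = 𝒰 := by
      refine Set.Finite.eq_of_subset_of_encard_le
        (Set.toFinite _) hsub ?_
      rwa [Set.encard_pair hVU.symm]
    rw [← hcov, ← heq, Set.sUnion_pair]
  · push Not at hs
    -- A cover by a single set counts as a cover by two equal sets.
    refine ⟨U, U, (hP U hU).1, (hP U hU).1, ?_, (hP U hU).2, (hP U hU).2⟩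
    have heq : 𝒰 = {U} := Set.eq_singleton_iff_unique_mem.2 ⟨hU, hs⟩
    rw [← hcov, heq, Set.union_self, Set.sUnion_singleton]

/-! ### The main theorem -/

theorem mainTheorem2 {X : Type u} [TopologicalSpace X] [T2Space X]
    [Topology.CWComplex (Set.univ : Set X)] [ConnectedSpace X] (x₀ : X) :
    (∀ F : Set (Subgroup (FundamentalGroup X x₀)), IsSubgroupFamily F → familyCat x₀ F ≤ 2 →
      ∃ (𝒢 : GraphOfGroups.{u}) (v₀ : 𝒢.V)
        (φ : 𝒢.fundamentalGroup v₀ ≃* FundamentalGroup X x₀),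
        𝒢.Connected ∧
        (∀ (v : 𝒢.V) (p : 𝒢.PathGroup) (hp : 𝒢.IsPath v₀ v p),
          Function.Injective (GraphOfGroups.vertexHom hp) ∧
          (GraphOfGroups.vertexHom hp).range.map φ.toMonoidHom ∈ F) ∧
        (∀ (e : 𝒢.E) (p : 𝒢.PathGroup) (hp : 𝒢.IsPath v₀ (𝒢.src e) p),
          Function.Injective (GraphOfGroups.edgeHom hp) ∧
          (GraphOfGroups.edgeHom hp).range.map φ.toMonoidHom ∈ F)) ∧
    (amenableCat X ≤ 2 →
      ∃ (𝒢 : GraphOfGroups.{u}) (v₀ : 𝒢.V),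
        Nonempty (𝒢.fundamentalGroup v₀ ≃* FundamentalGroup X x₀) ∧
        𝒢.Connected ∧
        (∀ v : 𝒢.V, IsAmenable (𝒢.vGroup v)) ∧
        (∀ e : 𝒢.E, IsAmenable (𝒢.eGroup e))) := by

  have := Topology.CWComplex.pathConnectedSpace (X := X)
  refine ⟨fun F hF hcat => ?_, fun hcat => ?_⟩
  · obtain ⟨U, V, hU, hV, hUV, hFU, hFV⟩ := exists_cover_of_coverCat_le_two hcat
    obtain ⟨𝔉⟩ := exists_compatibleFramings x₀ U V
    have hmem : ∀ (v : 𝔉.graph.V) (p : 𝔉.graph.PathGroup)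
        (hp : 𝔉.graph.IsPath (CompatibleFramings.vertexAt hUV x₀) v p),
        (GraphOfGroups.vertexHom hp).range.map
          (𝔉.fundamentalGroupEquiv hU hV hUV).toMonoidHom ∈ F := by
      intro v p hp
      rw [𝔉.map_range_vertexHom]
      -- Whatever path `p` is used, the image is a conjugate of the vertex subgroup.
      refine hF.conj_mem _ ?_ _
      rcases v with i | j
      · exact 𝔉.fU.group_mem_of_isFSet hFU i
      · exact 𝔉.fV.group_mem_of_isFSet hFV j
    refine ⟨𝔉.graph, CompatibleFramings.vertexAt hUV x₀, 𝔉.fundamentalGroupEquiv hU hV hUV,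
      𝔉.graph_connected hU hV hUV, fun v p hp => ⟨𝔉.vertexHom_injective hU hV hUV hp, hmem v p hp⟩,
      fun e p hp => ⟨(𝔉.vertexHom_injective hU hV hUV hp).comp (𝔉.graph.srcHom_injective e), ?_⟩⟩
    -- The image of an edge group lies in that of the vertex group at its origin.
    refine hF.subgroup_mem _ (hmem _ p hp) _ (Subgroup.map_mono ?_)
    rintro _ ⟨a, rfl⟩
    exact ⟨_, rfl⟩
  · obtain ⟨U, V, hU, hV, hUV, hAU, hAV⟩ := exists_cover_of_coverCat_le_two hcat
    obtain ⟨𝔉⟩ := exists_compatibleFramings x₀ U V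
    have hvert : ∀ v, IsAmenable (𝔉.vertexSubgroup v) := by
      rintro (i | j)
      · obtain ⟨e⟩ := 𝔉.fU.exists_group_mulEquiv i
        exact (hAU i.rep).of_injective e.symm.toMonoidHom e.symm.injective
      · obtain ⟨e⟩ := 𝔉.fV.exists_group_mulEquiv j
        exact (hAV j.rep).of_injective e.symm.toMonoidHom e.symm.injective
    exact ⟨𝔉.graph, CompatibleFramings.vertexAt hUV x₀, ⟨𝔉.fundamentalGroupEquiv hU hV hUV⟩,
      𝔉.graph_connected hU hV hUV, hvert,
      fun e => (hvert _).of_injective (𝔉.graph.srcHom e) (𝔉.graph.srcHom_injective e)⟩
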